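/- Let $d\ge 0$ be an integer. A weight on $\mathbf R^{2d}$ is a function $\omega:\mathbf R^{2d}\to(0,\infty)$ such that $\omega$ and $1/\omega$ belong to $L^\infty_{loc}(\mathbf R^{2d})$. For weights $\omega,v$ we say that $\omega$ is $v$-moderate if there is a constant $C>0$ such that $\omega(X+Y)\le C\,\omega(X)v(Y)$ for all $X,Y\in\mathbf R^{2d}$, and $\mathscr P_E(\mathbf R^{2d})$ denotes the set of all weights that are $v$-moderate for some weight $v$. For $p\in[1,\infty)$, $q\in(0,\infty)$ and $\omega\in\mathscr P_E(\mathbf R^{2d})$, the Wiener amalgam space $W\!L^{p,q}_{(\omega)}(\mathbf R^{2d})$ consists of all (classes modulo a.e. equality of) complex-valued measurable functions $f$ on $\mathbf R^{2d}$ such that $$\|f\|_{W\!L^{p,q}_{(\omega)}}=\Big(\sum_{k\in\mathbf Z^{2d}}\big(\|f\|_{L^p(k+[0,1]^{2d})}\,\omega(k)\big)^q\Big)^{1/q}<\infty .$$ The twisted convolution of $\mathfrak a$ and $\mathfrak b$ is $$(\mathfrak a*_\sigma\mathfrak b)(X)=\Big(\frac2\pi\Big)^{d/2}\int_{\mathbf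 R^{2d}}\mathfrak a(X-Y)\,\mathfrak b(Y)\,e^{2i\sigma(X,Y)}\,dY,\qquad \sigma(X,Y)=\langle y,\xi\rangle-\langle x,\eta\rangle,$$ for $X=(x,\xi)$, $Y=(y,\eta)$, and for sets $A,B$ of functions we write $A*_\sigma B=\{\mathfrak a*_\sigma\mathfrak b : \mathfrak a\in A,\ \mathfrak b\in B\}$. **Theorem.** Let $r\in(0,1]$, $p\in[1,\infty)$, $q\in[r,\infty)$, and let $\omega,v\in\mathscr P_E(\mathbf R^{2d})$ be such that $\omega$ is $v$-moderate. Then, for all $\mathfrak a\in W\!L^{1,r}_{(v)}(\mathbf R^{2d})$ and $\mathfrak b\in W\!L^{p,q}_{(\omega)}(\mathbf R^{2d})$, the integrals defining $\mathfrak a*_\sigma\mathfrak b$ and $\mathfrak b*_\sigma\mathfrak a$ converge absolutely at almost every $X\in\mathbf R^{2d}$, and $$W\!L^{1,r}_{(v)}(\mathbf R^{2d})*_\sigma W\!L^{p,q}_{(\omega)}(\mathbf R^{2d}) =W\!L^{p,q}_{(\omega)}(\mathbf R^{2d})*_\sigma W\!L^{1,r}_{(v)}(\mathbf R^{2d}) =W\!L^{p,q}_{(\omega)}(\mathbf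 R^{2d}).$$ -/

import Mathlib

open MeasureTheory
open scoped ENNReal

noncomputable section

namespace WienerAmalgam

/-! ### Weight functions on `ℝ^ι` (with `ι` a finite index set) -/

section Spaces

variable {ι : Type} [Fintype ι]

/-- A weight on `ℝ^ι`: a positive function `ω` such that `ω` and `1 / ω` belong to
`L^∞_loc`. -/
structure IsWeight (ω : (ι → ℝ) → ℝ) : Prop where
  pos : ∀ x, 0 < ω x
  locBdd : ∀ K : Set (ι → ℝ), IsCompact K → MemLp ω ∞ (volume.restrict K)
  locBdd_inv : ∀ K : Set (ι → ℝ), IsCompact K → MemLp (fun x => 1 / ω x) ∞ (volume.restrict K)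

/-- `ω` is `v`-moderate: `ω (x + y) ≤ C * ω x * v y` for all `x, y`, with `C > 0` independent
of `x` and `y`. -/
def IsModerateWrt (ω v : (ι → ℝ) → ℝ) : Prop :=
  ∃ C : ℝ, 0 < C ∧ ∀ x y, ω (x + y) ≤ C * ω x * v y

variable (ι) in
/-- The class `𝒫_E` of all moderate weights: the weights which are `v`-moderate for some
weight `v`. -/
def moderateWeights : Set ((ι → ℝ) → ℝ) :=
  {ω | IsWeight ω ∧ ∃ v, IsWeight v ∧ IsModerateWrt ω v}

/-! ### Wiener amalgam spaces -/

/-- The lattice point `k ∈ ℤ^ι`, regarded as an element of `ℝ^ι`. -/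
def latticePt (k : ι → ℤ) : ι → ℝ := fun i => (k i : ℝ)

/-- The cube `k + Q`, where `Q = [0,1]^ι`. -/
def cube (k : ι → ℤ) : Set (ι → ℝ) := Set.Icc (latticePt k) (latticePt k + 1)

/-- The (extended) quasi-norm of the Wiener amalgam space: the `ℓ^q`-norm over `k ∈ ℤ^ι` of
`‖f‖_{L^p(k + Q)} * ω k`. -/
def wienerNorm (p q : ℝ≥0∞) (ω : (ι → ℝ) → ℝ) (f : (ι → ℝ) → ℂ) : ℝ≥0∞ :=
  eLpNorm (fun k : ι → ℤ =>
    eLpNorm f p (volume.restrict (cube k)) * ENNReal.ofReal (ω (latticePt k))) q Measure.count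

/-- The Wiener amalgam space `WL^{p,q}_(ω)(ℝ^ι)`: all (almost everywhere equivalence classes
of) measurable functions with finite quasi-norm. -/
def wienerAmalgam (p q : ℝ≥0∞) (ω : (ι → ℝ) → ℝ) : Set ((ι → ℝ) →ₘ[volume] ℂ) :=
  {f | wienerNorm p q ω f < ∞}

end Spaces

/-! ### Twisted convolution on `ℝ^{2d}` -/

/-- Phase space `ℝ^{2d}`. A point `X = (x, ξ)` has `x i = X (Sum.inl i)` and
`ξ i = X (Sum.inr i)`. -/
abbrev Phase (d : ℕ) : Type := Fin d ⊕ Fin d → ℝ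

variable {d : ℕ}

/-- The symplectic form `σ(X, Y) = ⟨y, ξ⟩ - ⟨x, η⟩` for `X = (x, ξ)` and `Y = (y, η)`. -/
def symp (X Y : Phase d) : ℝ :=
  (∑ i, Y (Sum.inl i) * X (Sum.inr i)) - ∑ i, X (Sum.inl i) * Y (Sum.inr i)

/-- The integrand `a (X - Y) b (Y) e^{2 i σ(X, Y)}` of the twisted convolution. -/
def twistedIntegrand (a b : Phase d → ℂ) (X Y : Phase d) : ℂ :=
  a (X - Y) * b Y * Complex.exp (2 * Complex.I * (symp X Y : ℂ))

/-- The integral defining the twisted convolution converges absolutely at almost every point. -/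
def TwistedConvExists (a b : Phase d → ℂ) : Prop :=
  ∀ᵐ X : Phase d, Integrable (twistedIntegrand a b X)

/-- The twisted convolution of two functions,
`(a *_σ b)(X) = (2 / π)^{d / 2} ∫ a (X - Y) b (Y) e^{2 i σ(X, Y)} dY`. -/
def twistedConvFun (a b : Phase d → ℂ) (X : Phase d) : ℂ :=
  (((2 / Real.pi) ^ ((d : ℝ) / 2) : ℝ) : ℂ) * ∫ Y, twistedIntegrand a b X Y

theorem continuous_symp : Continuous fun z : Phase d × Phase d => symp z.1 z.2 := by
  unfold symp
  fun_prop

theorem aestronglyMeasurable_twistedConvFun {a b : Phase d → ℂ}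
    (ha : AEStronglyMeasurable a volume) (hb : AEStronglyMeasurable b volume) :
    AEStronglyMeasurable (twistedConvFun a b) volume := by
  have h1 : AEStronglyMeasurable (fun z : Phase d × Phase d => a (z.1 - z.2))
      (volume.prod volume) :=
    ha.comp_quasiMeasurePreserving (quasiMeasurePreserving_sub_of_right_invariant volume volume)
  have h2 : AEStronglyMeasurable (fun z : Phase d × Phase d => b z.2) (volume.prod volume) :=
    hb.comp_snd
  have h3 : AEStronglyMeasurable
      (fun z : Phase d × Phase d => Complex.exp (2 * Complex.I * (symp z.1 z.2 : ℂ)))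
      (volume.prod volume) := by
    have := continuous_symp (d := d)
    exact Continuous.aestronglyMeasurable (by fun_prop)
  have h : AEStronglyMeasurable (fun z : Phase d × Phase d => twistedIntegrand a b z.1 z.2)
      (volume.prod volume) := (h1.mul h2).mul h3
  exact (h.integral_prod_right').const_mul _

/-- The twisted convolution `a *_σ b` of two (equivalence classes of) measurable functions. -/
def twistedConv (a b : Phase d →ₘ[volume] ℂ) : Phase d →ₘ[volume] ℂ :=
  AEEqFun.mk (twistedConvFun a b)
    (aestronglyMeasurable_twistedConvFun a.aestronglyMeasurable b.aestronglyMeasurable)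

end WienerAmalgam

end

noncomputable section

namespace WienerAmalgam

/-! ### Countable sums and `L^p` quasi-norms of `ℝ≥0∞`-valued functions -/

/-! The inclusions into the amalgam space, and absolute convergence, come from a Young inequality.
Locally it is Minkowski and Jensen on cubes. On the lattice, the `r`-th power of the quasi-norm is
subadditive, because `t ↦ t ^ r` is subadditive and `q / r ≥ 1`. Moderateness transfers the weights
(`exists_nnAmalgam_nnConv_rpow_le`).

The reverse inclusion is a Cohen–Hewitt factorization in a quasi-Banach module. The `r`-th power of
the quasi-norm (`gauge`) makes the target a complete normed group. The left factor is sought among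
`L¹` functions supported in `[0,1]^{2d}`: there the `L¹` norm dominates the `(1, r)` amalgam norm
even for `r < 1`, so the left factors can converge in the Banach space `L¹`. Normalized indicators
of `[0, δ]^{2d}` form an approximate identity with constant `L¹` norm (`tendsto_tcFun_boxFun`).

Adjoin a formal unit `1`, and let `e` be a box and `l > 0` small enough that `1 + l e` is invertible
on the module, uniformly in `δ`. From `f = (b + m 1) g` pass to `g' = (1 + l)(1 + l e)⁻¹ g` and `b'
+ m' 1 = (1 + l)⁻¹ (b + m 1)(1 + l e)`, so that `f = (b' + m' 1) g'` with `m' = m / (1 + l)`. For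
small `δ` both changes are of order `m`, up to a chosen error (`exists_step`). Starting from `b =
0`, `m = 1`, `g = f`, the pairs form Cauchy sequences, the unit part dies geometrically, and the
limit is `f = b g` (`exists_factorization`).

All of this is done for the phase `e^{iθσ}` with arbitrary real `θ`. Reversing the factors changes
`θ` to `-θ`, so `θ = 2` and `θ = -2` give the two orders of the product. -/

theorem iSup_rpow {κ : Type*} (f : κ → ℝ≥0∞) {s : ℝ} (hs : 0 < s) :
    (⨆ i, f i) ^ s = ⨆ i, f i ^ s :=
  (ENNReal.orderIsoRpow s hs).map_iSup f

theorem tsum_rpow_le {κ : Type*} (f : κ → ℝ≥0∞) {s : ℝ} (hs : 0 < s) (hs1 : s ≤ 1) :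
    (∑' i, f i) ^ s ≤ ∑' i, f i ^ s := by
  classical
  have hfin : ∀ t : Finset κ, (∑ i ∈ t, f i) ^ s ≤ ∑ i ∈ t, f i ^ s := by
    intro t
    induction t using Finset.induction_on with
    | empty => simp [hs]
    | insert a t ha ih =>
      rw [Finset.sum_insert ha, Finset.sum_insert ha]
      exact (ENNReal.rpow_add_le_add_rpow _ _ hs.le hs1).trans (by gcongr)
  rw [ENNReal.tsum_eq_iSup_sum, iSup_rpow _ hs]
  exact iSup_le fun t => (hfin t).trans (ENNReal.sum_le_tsum t)

/-- Minkowski's inequality for finite sums, passed to the supremum over finite subsets by monotone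
convergence. -/
theorem eLpNorm_tsum_le {α κ : Type*} [MeasurableSpace α] [Countable κ] {μ : Measure α}
    {p : ℝ≥0∞} (hp1 : 1 ≤ p) (hp : p < ∞) {F : κ → α → ℝ≥0∞} (hF : ∀ i, AEMeasurable (F i) μ) :
    eLpNorm (fun x => ∑' i, F i x) p μ ≤ ∑' i, eLpNorm (F i) p μ := by
  classical
  have hp0 : p ≠ 0 := (zero_lt_one.trans_le hp1).ne'
  have hpos : 0 < p.toReal := ENNReal.toReal_pos hp0 hp.ne
  have h1 : eLpNorm (fun x => ∑' i, F i x) p μ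
      = ⨆ t : Finset κ, eLpNorm (∑ i ∈ t, F i) p μ := by
    simp only [eLpNorm_eq_lintegral_rpow_enorm_toReal hp0 hp.ne, enorm_eq_self]
    rw [← iSup_rpow _ (by positivity), ← lintegral_iSup_directed]
    · congr 2
      funext x
      rw [ENNReal.tsum_eq_iSup_sum, iSup_rpow _ hpos]
      simp
    · intro t
      exact (Finset.aemeasurable_sum t fun i _ => hF i).pow_const _
    · refine Monotone.directed_le ?_
      intro s t hst x
      simp only [Finset.sum_apply]
      gcongr
  rw [h1]
  refine iSup_le fun t => ?_
  exact (eLpNorm_sum_le (fun i _ => (hF i).aestronglyMeasurable) hp1).trans (ENNReal.sum_le_tsum t)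

theorem eLpNorm_const_mul_ennreal {α : Type*} [MeasurableSpace α] {μ : Measure α}
    {p : ℝ≥0∞} (hp0 : p ≠ 0) (hp : p ≠ ∞) (c : ℝ≥0∞) {F : α → ℝ≥0∞} (hF : AEMeasurable F μ) :
    eLpNorm (fun x => c * F x) p μ = c * eLpNorm F p μ := by
  have hpos : 0 < p.toReal := ENNReal.toReal_pos hp0 hp
  simp only [eLpNorm_eq_lintegral_rpow_enorm_toReal hp0 hp, enorm_eq_self]
  simp_rw [ENNReal.mul_rpow_of_nonneg _ _ hpos.le]
  rw [lintegral_const_mul'' _ (hF.pow_const _), ENNReal.mul_rpow_of_nonneg _ _ (by positivity),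
    ← ENNReal.rpow_mul, mul_one_div_cancel hpos.ne', ENNReal.rpow_one]

/-! ### Convolution of nonnegative functions and Young's inequality -/

section Conv

variable {ι : Type} [Fintype ι]

/-- The convolution `∫ A (Y) F (X - Y) dY` of two nonnegative functions. -/
def nnConv (A F : (ι → ℝ) → ℝ≥0∞) (X : ι → ℝ) : ℝ≥0∞ := ∫⁻ Y, A Y * F (X - Y)

theorem nnConv_comm (A F : (ι → ℝ) → ℝ≥0∞) : nnConv A F = nnConv F A := by
  funext X
  unfold nnConv
  rw [← lintegral_sub_left_eq_self (fun Y => A Y * F (X - Y)) X]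
  simp [mul_comm]

theorem measurable_nnConv {A F : (ι → ℝ) → ℝ≥0∞} (hA : Measurable A) (hF : Measurable F) :
    Measurable (nnConv A F) := by
  unfold nnConv
  refine Measurable.lintegral_prod_right' (f := fun z : (ι → ℝ) × (ι → ℝ) => A z.2 * F (z.1 - z.2)) ?_
  fun_prop

/-- Hölder's inequality for the measure `A μ`, comparing the `L¹` and `L^p` norms of `G`; the factor
is a power of the total mass of `A μ`. -/
theorem lintegral_mul_rpow_le {α : Type*} [MeasurableSpace α] (μ : Measure α) {A G : α → ℝ≥0∞}
    (hA : Measurable A) (hG : Measurable G) {p : ℝ} (hp : 1 ≤ p) :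
    (∫⁻ y, A y * G y ∂μ) ^ p ≤ (∫⁻ y, A y ∂μ) ^ (p - 1) * ∫⁻ y, A y * G y ^ p ∂μ := by
  have hp0 : 0 < p := by linarith
  have h := eLpNorm'_le_eLpNorm'_mul_rpow_measure_univ (μ := μ.withDensity A) one_pos hp
    (f := G) hG.aestronglyMeasurable
  simp only [eLpNorm', enorm_eq_self, ENNReal.rpow_one, div_one, withDensity_apply _ MeasurableSet.univ,
    Measure.restrict_univ] at h
  rw [lintegral_withDensity_eq_lintegral_mul _ hA hG,
    lintegral_withDensity_eq_lintegral_mul _ hA (hG.pow_const p)] at h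
  refine (ENNReal.rpow_le_rpow h hp0.le).trans ?_
  rw [ENNReal.mul_rpow_of_nonneg _ _ hp0.le, ← ENNReal.rpow_mul, ← ENNReal.rpow_mul, mul_comm]
  have e1 : 1 / p * p = 1 := by field_simp
  have e2 : (1 - 1 / p) * p = p - 1 := by field_simp
  rw [e1, e2, ENNReal.rpow_one]
  rfl

/-- A local form of Young's inequality. -/
theorem eLpNorm_setLIntegral_conv_le {A F : (ι → ℝ) → ℝ≥0∞} (hA : Measurable A) (hF : Measurable F)
    {p : ℝ≥0∞} (hp1 : 1 ≤ p) (hp : p < ∞) {S T U : Set (ι → ℝ)} (hS : MeasurableSet S)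
    (hT : MeasurableSet T) (hU : MeasurableSet U) (hSTU : ∀ x ∈ S, ∀ y ∈ T, x - y ∈ U) :
    eLpNorm (fun X => ∫⁻ Y in T, A Y * F (X - Y)) p (volume.restrict S)
      ≤ (∫⁻ Y in T, A Y) * eLpNorm F p (volume.restrict U) := by
  have hp0 : p ≠ 0 := (zero_lt_one.trans_le hp1).ne'
  have hP1 : 1 ≤ p.toReal := by
    simpa using ENNReal.toReal_mono hp.ne hp1
  have hP : 0 < p.toReal := by linarith
  simp only [eLpNorm_eq_lintegral_rpow_enorm_toReal hp0 hp.ne, enorm_eq_self]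
  set P := p.toReal
  set I := ∫⁻ Y in T, A Y with hI
  have key : ∫⁻ X in S, (∫⁻ Y in T, A Y * F (X - Y)) ^ P ≤ I ^ P * ∫⁻ X in U, F X ^ P := by
    calc ∫⁻ X in S, (∫⁻ Y in T, A Y * F (X - Y)) ^ P
        ≤ ∫⁻ X in S, I ^ (P - 1) * ∫⁻ Y in T, A Y * F (X - Y) ^ P := by
          refine lintegral_mono fun X => ?_
          exact lintegral_mul_rpow_le _ hA (by fun_prop) hP1
      _ = I ^ (P - 1) * ∫⁻ X in S, ∫⁻ Y in T, A Y * F (X - Y) ^ P := by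
          refine lintegral_const_mul _ ?_
          refine Measurable.lintegral_prod_right'
            (f := fun z : (ι → ℝ) × (ι → ℝ) => A z.2 * F (z.1 - z.2) ^ P) ?_
          fun_prop
      _ = I ^ (P - 1) * ∫⁻ Y in T, ∫⁻ X in S, A Y * F (X - Y) ^ P := by
          rw [lintegral_lintegral_swap]
          fun_prop
      _ ≤ I ^ (P - 1) * ∫⁻ Y in T, A Y * ∫⁻ X in U, F X ^ P := by
          refine mul_le_mul_right (setLIntegral_mono' hT fun Y hY => ?_) _
          rw [lintegral_const_mul _ (by fun_prop)]
          refine mul_le_mul_right ?_ _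
          -- Translating by `Y ∈ T` carries `S` into `U`, so the inner integral is at most the
          -- integral over `U`.
          rw [← lintegral_indicator hS, ← lintegral_indicator hU,
            ← lintegral_sub_right_eq_self (U.indicator fun X => F X ^ P) Y]
          refine lintegral_mono fun X => ?_
          by_cases hX : X ∈ S
          · rw [Set.indicator_of_mem hX, Set.indicator_of_mem (hSTU X hX Y hY)]
          · rw [Set.indicator_of_notMem hX]
            exact zero_le
      _ = I ^ P * ∫⁻ X in U, F X ^ P := by
          rw [lintegral_mul_const _ hA, ← hI, ← mul_assoc]
          congr 1
          nth_rewrite 2 [← ENNReal.rpow_one I]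
          rw [← ENNReal.rpow_add_of_nonneg _ _ (by linarith) (by norm_num)]
          congr 1
          ring
  calc _ ≤ (I ^ P * ∫⁻ X in U, F X ^ P) ^ (1 / P) := ENNReal.rpow_le_rpow key (by positivity)
    _ = _ := by
      rw [ENNReal.mul_rpow_of_nonneg _ _ (by positivity), ← ENNReal.rpow_mul,
        mul_one_div_cancel hP.ne', ENNReal.rpow_one]

theorem eLpNorm_nnConv_le {A F : (ι → ℝ) → ℝ≥0∞} (hA : Measurable A) (hF : Measurable F)
    {p : ℝ≥0∞} (hp1 : 1 ≤ p) (hp : p < ∞) :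
    eLpNorm (nnConv A F) p volume ≤ (∫⁻ Y, A Y) * eLpNorm F p volume := by
  simpa [nnConv, funext_iff] using! eLpNorm_setLIntegral_conv_le hA hF hp1 hp MeasurableSet.univ MeasurableSet.univ
    MeasurableSet.univ (by simp)

end Conv

end WienerAmalgam

end

noncomputable section

namespace WienerAmalgam

/-! ### Amalgam quasi-norms of nonnegative functions -/

section NNAmalgam

theorem floor_mem_cube {ι : Type} (x : ι → ℝ) : x ∈ cube (fun i => ⌊x i⌋) := by
  refine ⟨fun i => Int.floor_le _, fun i => ?_⟩
  simpa [latticePt] using (Int.lt_floor_add_one (x i)).le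

theorem iUnion_cube {ι : Type} : (⋃ k : ι → ℤ, cube k) = Set.univ :=
  Set.eq_univ_of_forall fun x => Set.mem_iUnion.2 ⟨_, floor_mem_cube x⟩

theorem latticePt_add {ι : Type} (j k : ι → ℤ) : latticePt (j + k) = latticePt j + latticePt k := by
  funext i
  simp [latticePt]

variable {ι : Type} [Fintype ι]

/-- The Wiener amalgam quasi-norm of an `ℝ≥0∞`-valued function. -/
def nnAmalgam (p q : ℝ≥0∞) (ω : (ι → ℝ) → ℝ) (F : (ι → ℝ) → ℝ≥0∞) : ℝ≥0∞ :=
  eLpNorm (fun k : ι → ℤ =>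
    eLpNorm F p (volume.restrict (cube k)) * ENNReal.ofReal (ω (latticePt k))) q Measure.count

theorem wienerNorm_eq_nnAmalgam (p q : ℝ≥0∞) (ω : (ι → ℝ) → ℝ) (f : (ι → ℝ) → ℂ) :
    wienerNorm p q ω f = nnAmalgam p q ω (fun x => ‖f x‖ₑ) := by
  simp [wienerNorm, nnAmalgam, eLpNorm_enorm]

theorem measurableSet_cube (k : ι → ℤ) : MeasurableSet (cube k) := measurableSet_Icc

theorem nnAmalgam_mono_ae {p q : ℝ≥0∞} {ω : (ι → ℝ) → ℝ} {F G : (ι → ℝ) → ℝ≥0∞}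
    (h : ∀ᵐ x, F x ≤ G x) : nnAmalgam p q ω F ≤ nnAmalgam p q ω G := by
  refine eLpNorm_mono_enorm fun k => ?_
  simp only [enorm_eq_self]
  gcongr ?_ * _
  exact eLpNorm_mono_enorm_ae (by simpa using ae_restrict_of_ae h)

theorem nnAmalgam_mono {p q : ℝ≥0∞} {ω : (ι → ℝ) → ℝ} {F G : (ι → ℝ) → ℝ≥0∞}
    (h : ∀ x, F x ≤ G x) : nnAmalgam p q ω F ≤ nnAmalgam p q ω G :=
  nnAmalgam_mono_ae (Filter.Eventually.of_forall h)

/-- The point of this form: when `r ≤ q`, the outer exponent `q / r` is at least `1`, so Minkowski's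
inequality applies on the lattice. -/
theorem nnAmalgam_rpow {p q r : ℝ≥0∞} (hr0 : 0 < r) (hr : r ≠ ∞) (ω : (ι → ℝ) → ℝ)
    (F : (ι → ℝ) → ℝ≥0∞) :
    nnAmalgam p q ω F ^ r.toReal = eLpNorm (fun k : ι → ℤ =>
      (eLpNorm F p (volume.restrict (cube k)) * ENNReal.ofReal (ω (latticePt k))) ^ r.toReal)
      (q / r) Measure.count := by
  have h := eLpNorm_enorm_rpow (p := q / r) (μ := Measure.count) (fun k : ι → ℤ =>
      (eLpNorm F p (volume.restrict (cube k)) * ENNReal.ofReal (ω (latticePt k))))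
      (ENNReal.toReal_pos hr0.ne' hr)
  rw [ENNReal.ofReal_toReal hr, ENNReal.div_mul_cancel hr0.ne' hr] at h
  simpa [nnAmalgam] using h.symm

theorem nnAmalgam_const_mul {p q : ℝ≥0∞} (hp1 : 1 ≤ p) (hp : p < ∞) (hq0 : 0 < q) (hq : q < ∞)
    (ω : (ι → ℝ) → ℝ) (c : ℝ≥0∞) {F : (ι → ℝ) → ℝ≥0∞} (hF : Measurable F) :
    nnAmalgam p q ω (fun x => c * F x) = c * nnAmalgam p q ω F := by
  unfold nnAmalgam
  rw [← eLpNorm_const_mul_ennreal hq0.ne' hq.ne _ (Measurable.of_discrete.aemeasurable)]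
  congr 1
  funext k
  rw [eLpNorm_const_mul_ennreal (zero_lt_one.trans_le hp1).ne' hp.ne _ hF.aemeasurable, mul_assoc]

theorem one_le_div {q r : ℝ≥0∞} (hr0 : 0 < r) (hr : r ≠ ∞) (hqr : r ≤ q) : 1 ≤ q / r := by
  rw [ENNReal.le_div_iff_mul_le (Or.inl hr0.ne') (Or.inl hr)]
  simpa using hqr

/-- The countable `r`-triangle inequality: Minkowski in `L^p` on each cube, subadditivity of `t ↦ t
^ r`, then Minkowski in `ℓ^{q/r}`. -/
theorem nnAmalgam_tsum_rpow_le {κ : Type*} [Countable κ] {p q r : ℝ≥0∞} (hr0 : 0 < r) (hr1 : r ≤ 1)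
    (hp1 : 1 ≤ p) (hp : p < ∞) (hqr : r ≤ q) (hq : q < ∞) (ω : (ι → ℝ) → ℝ)
    {F : κ → (ι → ℝ) → ℝ≥0∞} (hF : ∀ i, Measurable (F i)) :
    nnAmalgam p q ω (fun x => ∑' i, F i x) ^ r.toReal
      ≤ ∑' i, nnAmalgam p q ω (F i) ^ r.toReal := by
  have hr : r ≠ ∞ := (hr1.trans_lt ENNReal.one_lt_top).ne
  have hR : 0 < r.toReal := ENNReal.toReal_pos hr0.ne' hr
  have hR1 : r.toReal ≤ 1 := by simpa using ENNReal.toReal_mono ENNReal.one_ne_top hr1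
  simp only [nnAmalgam_rpow hr0 hr]
  refine le_trans ?_ (eLpNorm_tsum_le (one_le_div hr0 hr hqr)
    (ENNReal.div_lt_top hq.ne hr0.ne') fun i => Measurable.of_discrete.aemeasurable)
  refine eLpNorm_mono_enorm fun k => ?_
  simp only [enorm_eq_self]
  refine le_trans ?_ (tsum_rpow_le _ hR hR1)
  rw [ENNReal.tsum_mul_right]
  gcongr
  exact eLpNorm_tsum_le hp1 hp fun i => (hF i).aemeasurable

theorem nnAmalgam_add_rpow_le {p q r : ℝ≥0∞} (hr0 : 0 < r) (hr1 : r ≤ 1)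
    (hp1 : 1 ≤ p) (hp : p < ∞) (hqr : r ≤ q) (hq : q < ∞) (ω : (ι → ℝ) → ℝ)
    {F G : (ι → ℝ) → ℝ≥0∞} (hF : Measurable F) (hG : Measurable G) :
    nnAmalgam p q ω (fun x => F x + G x) ^ r.toReal
      ≤ nnAmalgam p q ω F ^ r.toReal + nnAmalgam p q ω G ^ r.toReal := by
  have h := nnAmalgam_tsum_rpow_le (κ := Bool) hr0 hr1 hp1 hp hqr hq ω
    (F := fun b => cond b F G) (by rintro (_ | _) <;> assumption)
  simpa [tsum_bool, add_comm] using h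

/-- Index set of the cubes meeting `[-1, 1]^ι`. -/
def neighbors (ι : Type) [Fintype ι] : Finset (ι → ℤ) :=
  open Classical in Finset.Icc (-1) 1

theorem mem_neighbors {e : ι → ℤ} : e ∈ neighbors ι ↔ -1 ≤ e ∧ e ≤ 1 := by
  classical
  rw [neighbors, Finset.mem_Icc]

theorem sub_mem_iUnion_cube {m j : ι → ℤ} {x y : ι → ℝ} (hx : x ∈ cube m) (hy : y ∈ cube j) :
    x - y ∈ ⋃ e : neighbors ι, cube (m - j + (e : ι → ℤ)) := by
  have hb : ∀ i, ((m i : ℝ) ≤ x i ∧ x i ≤ m i + 1) ∧ ((j i : ℝ) ≤ y i ∧ y i ≤ j i + 1) :=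
    fun i => ⟨⟨hx.1 i, hx.2 i⟩, ⟨hy.1 i, hy.2 i⟩⟩
  rw [Set.mem_iUnion]
  refine ⟨⟨(fun i => ⌊x i - y i⌋) - (m - j), ?_⟩, ?_⟩
  · rw [mem_neighbors]
    refine ⟨fun i => ?_, fun i => ?_⟩
    · have h1 := hb i
      have h2 : (m i - j i - 1 : ℤ) ≤ ⌊x i - y i⌋ := by
        rw [Int.le_floor]
        push_cast
        linarith
      simp only [Pi.neg_apply, Pi.one_apply, Pi.sub_apply]
      linarith
    · have h1 := hb i
      have h2 : (⌊x i - y i⌋ : ℝ) ≤ ((m i - j i + 1 : ℤ) : ℝ) := by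
        refine (Int.floor_le _).trans ?_
        push_cast
        linarith
      have h3 := Int.cast_le.1 h2
      simp only [Pi.one_apply, Pi.sub_apply]
      linarith
  · rw [add_sub_cancel]
    exact floor_mem_cube (x - y)

theorem eLpNorm_restrict_iUnion_le {α κ : Type*} [MeasurableSpace α] {μ : Measure α} [Countable κ]
    {p : ℝ≥0∞} (hp1 : 1 ≤ p) (hp : p < ∞) {F : α → ℝ≥0∞} (hF : Measurable F) {s : κ → Set α}
    (hs : ∀ i, MeasurableSet (s i)) :
    eLpNorm F p (μ.restrict (⋃ i, s i)) ≤ ∑' i, eLpNorm F p (μ.restrict (s i)) := by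
  rw [← eLpNorm_indicator_eq_eLpNorm_restrict (MeasurableSet.iUnion hs)]
  calc _ ≤ eLpNorm (fun x => ∑' i, (s i).indicator F x) p μ := by
        refine eLpNorm_mono_enorm fun x => ?_
        simp only [enorm_eq_self]
        by_cases hx : x ∈ ⋃ i, s i
        · rw [Set.indicator_of_mem hx]
          obtain ⟨i, hi⟩ := Set.mem_iUnion.1 hx
          refine le_trans ?_ (ENNReal.le_tsum i)
          rw [Set.indicator_of_mem hi]
        · rw [Set.indicator_of_notMem hx]
          exact zero_le
    _ ≤ _ := eLpNorm_tsum_le hp1 hp fun i => (hF.indicator (hs i)).aemeasurable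
    _ = _ := tsum_congr fun i => eLpNorm_indicator_eq_eLpNorm_restrict (hs i)

/-- Split the integration variable into cubes `j`. For `X` in cube `m`, the difference `X - Y` stays
within the cubes adjacent to `m - j`, and the local Young inequality applies to each piece. -/
theorem eLpNorm_nnConv_cube_le {A F : (ι → ℝ) → ℝ≥0∞} (hA : Measurable A) (hF : Measurable F)
    {p : ℝ≥0∞} (hp1 : 1 ≤ p) (hp : p < ∞) (m : ι → ℤ) :
    eLpNorm (nnConv A F) p (volume.restrict (cube m))
      ≤ ∑' j : ι → ℤ, ∑' e : neighbors ι, eLpNorm A 1 (volume.restrict (cube j)) *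
        eLpNorm F p (volume.restrict (cube (m - j + e))) := by
  have h1 : ∀ X, nnConv A F X ≤ ∑' j : ι → ℤ, ∫⁻ Y in cube j, A Y * F (X - Y) := by
    intro X
    unfold nnConv
    rw [← setLIntegral_univ, ← iUnion_cube]
    exact lintegral_iUnion_le _ _
  have hmeas : ∀ j : ι → ℤ, Measurable fun X => ∫⁻ Y in cube j, A Y * F (X - Y) := by
    intro j
    refine Measurable.lintegral_prod_right'
      (f := fun z : (ι → ℝ) × (ι → ℝ) => A z.2 * F (z.1 - z.2)) ?_
    fun_prop
  refine (eLpNorm_mono_enorm (g := fun X => ∑' j : ι → ℤ, ∫⁻ Y in cube j, A Y * F (X - Y))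
    (by simpa using h1)).trans ?_
  refine (eLpNorm_tsum_le hp1 hp fun j => (hmeas j).aemeasurable).trans ?_
  refine ENNReal.tsum_le_tsum fun j => ?_
  rw [ENNReal.tsum_mul_left, eLpNorm_one_eq_lintegral_enorm]
  simp only [enorm_eq_self]
  have hU : MeasurableSet (⋃ e : neighbors ι, cube (m - j + (e : ι → ℤ))) :=
    MeasurableSet.iUnion fun e => measurableSet_cube _
  refine (eLpNorm_setLIntegral_conv_le hA hF hp1 hp (measurableSet_cube m) (measurableSet_cube j)
    hU ?_).trans ?_
  · intro x hx y hy
    exact sub_mem_iUnion_cube hx hy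
  · gcongr
    exact eLpNorm_restrict_iUnion_le hp1 hp hF fun e => measurableSet_cube _

/-- Lattice values of a moderate pair of weights. -/
theorem exists_weight_bound {ω v : (ι → ℝ) → ℝ} (hω : ∀ x, 0 < ω x)
    (hv : v ∈ moderateWeights ι) (hωv : IsModerateWrt ω v) :
    ∃ C : ℝ≥0∞, C ≠ ∞ ∧ ∀ m j : ι → ℤ, ∀ e ∈ neighbors ι,
      ENNReal.ofReal (ω (latticePt m))
        ≤ C * (ENNReal.ofReal (v (latticePt j)) * ENNReal.ofReal (ω (latticePt (m - j + e)))) := by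
  obtain ⟨C, hC, h⟩ := hωv
  obtain ⟨hvw, u, hu, C', hC', h'⟩ := hv
  -- Moderateness of `ω` produces `v (j - e)`, and moderateness of `v` itself removes the shift at
  -- the price of `u (-e)`. The sum over the finitely many `e` bounds this uniformly.
  refine ⟨ENNReal.ofReal (C * (C' * ∑ e ∈ neighbors ι, u (latticePt (-e)))), ENNReal.ofReal_ne_top, ?_⟩
  intro m j e he
  have hS : 0 ≤ C' * ∑ e ∈ neighbors ι, u (latticePt (-e)) :=
    mul_nonneg hC'.le (Finset.sum_nonneg fun e _ => (hu.pos _).le)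
  rw [← ENNReal.ofReal_mul (hvw.pos _).le, ← ENNReal.ofReal_mul (mul_nonneg hC.le hS)]
  refine ENNReal.ofReal_le_ofReal ?_
  have e1 : latticePt m = latticePt (m - j + e) + latticePt (j + -e) := by
    rw [← latticePt_add]; congr 1; abel
  have h1 := h (latticePt (m - j + e)) (latticePt (j + -e))
  rw [← e1] at h1
  have h2 := h' (latticePt j) (latticePt (-e))
  rw [← latticePt_add] at h2
  have h3 : u (latticePt (-e)) ≤ ∑ e ∈ neighbors ι, u (latticePt (-e)) :=
    Finset.single_le_sum (f := fun e => u (latticePt (-e))) (fun e _ => (hu.pos _).le) he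
  have hw := hω (latticePt (m - j + e))
  have hvj := hvw.pos (latticePt j)
  calc ω (latticePt m) ≤ C * ω (latticePt (m - j + e)) * v (latticePt (j + -e)) := h1
    _ ≤ C * ω (latticePt (m - j + e)) * (C' * v (latticePt j) *
        ∑ e ∈ neighbors ι, u (latticePt (-e))) := by
      gcongr
      exact h2.trans (by gcongr)
    _ = _ := by ring

/-- A lattice Young inequality `ℓ¹ * ℓ^{q/r} ⊆ ℓ^{q/r}` applied to `r`-th powers of the weighted
local norms; translation invariance of counting measure makes every shifted copy of `β` contribute
equally. -/
theorem exists_nnAmalgam_nnConv_rpow_le {p q r : ℝ≥0∞} (hr0 : 0 < r) (hr1 : r ≤ 1)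
    (hp1 : 1 ≤ p) (hp : p < ∞) (hqr : r ≤ q) (hq : q < ∞) {ω v : (ι → ℝ) → ℝ}
    (hω : ∀ x, 0 < ω x) (hv : v ∈ moderateWeights ι) (hωv : IsModerateWrt ω v) :
    ∃ K : ℝ≥0∞, K ≠ ∞ ∧ ∀ A F : (ι → ℝ) → ℝ≥0∞, Measurable A → Measurable F →
      nnAmalgam p q ω (nnConv A F) ^ r.toReal
        ≤ K * (nnAmalgam 1 r v A ^ r.toReal * nnAmalgam p q ω F ^ r.toReal) := by
  have hr : r ≠ ∞ := (hr1.trans_lt ENNReal.one_lt_top).ne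
  have hR : 0 < r.toReal := ENNReal.toReal_pos hr0.ne' hr
  have hR1 : r.toReal ≤ 1 := by simpa using ENNReal.toReal_mono ENNReal.one_ne_top hr1
  obtain ⟨C, hC, hCb⟩ := exists_weight_bound hω hv hωv
  have hs1 := one_le_div hr0 hr hqr
  have hs := ENNReal.div_lt_top hq.ne hr0.ne'
  have hs0 : q / r ≠ 0 := (zero_lt_one.trans_le hs1).ne'
  refine ⟨C ^ r.toReal * (neighbors ι).card, ENNReal.mul_ne_top
    (ENNReal.rpow_ne_top_of_nonneg hR.le hC) (ENNReal.natCast_ne_top _), ?_⟩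
  intro A F hA hF
  set α : (ι → ℤ) → ℝ≥0∞ := fun j =>
    eLpNorm A 1 (volume.restrict (cube j)) * ENNReal.ofReal (v (latticePt j)) with hα
  set β : (ι → ℤ) → ℝ≥0∞ := fun k =>
    eLpNorm F p (volume.restrict (cube k)) * ENNReal.ofReal (ω (latticePt k)) with hβ
  have hN1 : nnAmalgam 1 r v A ^ r.toReal = ∑' j, α j ^ r.toReal := by
    rw [nnAmalgam_rpow hr0 hr, ENNReal.div_self hr0.ne' hr, eLpNorm_one_eq_lintegral_enorm,
      lintegral_count]
    simp [hα]
  have hN2 : ∀ a : ι → ℤ,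
      eLpNorm (fun m => β (m + a) ^ r.toReal) (q / r) Measure.count
        = nnAmalgam p q ω F ^ r.toReal := by
    intro a
    rw [nnAmalgam_rpow hr0 hr]
    exact eLpNorm_comp_measurePreserving (g := fun m => β m ^ r.toReal)
      Measurable.of_discrete.aestronglyMeasurable (measurePreserving_add_right Measure.count a)
  rw [nnAmalgam_rpow hr0 hr (F := nnConv A F), hN1]
  calc _ ≤ eLpNorm (fun m : ι → ℤ => ∑' j : ι → ℤ, ∑' e : neighbors ι,
          C ^ r.toReal * α j ^ r.toReal * β (m + (-j + e)) ^ r.toReal) (q / r) Measure.count := by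
        refine eLpNorm_mono_enorm fun m => ?_
        simp only [enorm_eq_self]
        have h1 : eLpNorm (nnConv A F) p (volume.restrict (cube m)) * ENNReal.ofReal (ω (latticePt m))
            ≤ ∑' j : ι → ℤ, ∑' e : neighbors ι, C * α j * β (m + (-j + e)) := by
          refine (mul_le_mul_left (eLpNorm_nnConv_cube_le hA hF hp1 hp m) _).trans ?_
          rw [← ENNReal.tsum_mul_right]
          refine ENNReal.tsum_le_tsum fun j => ?_
          rw [← ENNReal.tsum_mul_right]
          refine ENNReal.tsum_le_tsum fun e => ?_
          have e1 : m + (-j + (e : ι → ℤ)) = m - j + e := by abel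
          refine (mul_le_mul_right (hCb m j e e.2) _).trans (le_of_eq ?_)
          simp only [hα, hβ, e1]
          ring
        refine (ENNReal.rpow_le_rpow h1 hR.le).trans ((tsum_rpow_le _ hR hR1).trans ?_)
        refine ENNReal.tsum_le_tsum fun j => (tsum_rpow_le _ hR hR1).trans (le_of_eq ?_)
        refine tsum_congr fun e => ?_
        rw [ENNReal.mul_rpow_of_nonneg _ _ hR.le, ENNReal.mul_rpow_of_nonneg _ _ hR.le]
    _ ≤ ∑' j : ι → ℤ, ∑' e : neighbors ι,
          C ^ r.toReal * α j ^ r.toReal * nnAmalgam p q ω F ^ r.toReal := by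
        refine (eLpNorm_tsum_le hs1 hs fun j => Measurable.of_discrete.aemeasurable).trans ?_
        refine ENNReal.tsum_le_tsum fun j => ?_
        refine (eLpNorm_tsum_le hs1 hs fun j => Measurable.of_discrete.aemeasurable).trans ?_
        refine ENNReal.tsum_le_tsum fun e => ?_
        rw [eLpNorm_const_mul_ennreal hs0 hs.ne _ Measurable.of_discrete.aemeasurable, hN2]
    _ = _ := by
        simp only [tsum_fintype, Finset.sum_const, Finset.card_univ, Fintype.card_coe, nsmul_eq_mul]
        rw [← ENNReal.tsum_mul_right, ← ENNReal.tsum_mul_left]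
        refine tsum_congr fun j => ?_
        ring

theorem ae_lt_top_of_nnAmalgam_lt_top {p q : ℝ≥0∞} (hp1 : 1 ≤ p) (hp : p < ∞) (hq0 : 0 < q)
    (hq : q < ∞) {ω : (ι → ℝ) → ℝ} (hω : ∀ x, 0 < ω x) {F : (ι → ℝ) → ℝ≥0∞} (hF : Measurable F)
    (h : nnAmalgam p q ω F < ∞) : ∀ᵐ x, F x < ∞ := by
  have hp0 : p ≠ 0 := (zero_lt_one.trans_le hp1).ne'
  have hP : 0 < p.toReal := ENNReal.toReal_pos hp0 hp.ne
  have hQ : 0 < q.toReal := ENNReal.toReal_pos hq0.ne' hq.ne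
  unfold nnAmalgam at h
  rw [eLpNorm_lt_top_iff_lintegral_rpow_enorm_lt_top hq0.ne' hq.ne, lintegral_count] at h
  have hk : ∀ k : ι → ℤ, ∀ᵐ x ∂(volume.restrict (cube k)), F x < ∞ := by
    intro k
    have h1 := ENNReal.ne_top_of_tsum_ne_top h.ne k
    have h2 : eLpNorm F p (volume.restrict (cube k)) < ∞ := by
      by_contra hcon
      rw [not_lt, top_le_iff] at hcon
      rw [hcon, ENNReal.top_mul (by simpa using hω _)] at h1
      simp [hQ] at h1
    rw [eLpNorm_lt_top_iff_lintegral_rpow_enorm_lt_top hp0 hp.ne] at h2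
    filter_upwards [ae_lt_top (by fun_prop) h2.ne] with x hx
    simpa [hP, ENNReal.rpow_eq_top_iff, hP.le, not_lt.2 hP.le, lt_top_iff_ne_top] using hx
  rw [← Measure.restrict_univ (μ := volume), ← iUnion_cube, ae_restrict_iUnion_iff]
  exact hk

theorem ae_eq_zero_of_nnAmalgam_eq_zero {p q : ℝ≥0∞} (hp1 : 1 ≤ p) (hq0 : 0 < q)
    {ω : (ι → ℝ) → ℝ} (hω : ∀ x, 0 < ω x) {F : (ι → ℝ) → ℝ≥0∞} (hF : Measurable F)
    (h : nnAmalgam p q ω F = 0) : ∀ᵐ x, F x = 0 := by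
  have hp0 : p ≠ 0 := (zero_lt_one.trans_le hp1).ne'
  unfold nnAmalgam at h
  rw [eLpNorm_eq_zero_iff Measurable.of_discrete.aestronglyMeasurable hq0.ne'] at h
  have h' : ∀ k : ι → ℤ, _ := fun k => Measure.ae_count_iff.1 h k
  rw [← Measure.restrict_univ (μ := volume), ← iUnion_cube, ae_restrict_iUnion_iff]
  intro k
  have h1 := h' k
  simp only [Pi.zero_apply, mul_eq_zero, ENNReal.ofReal_eq_zero, not_le.2 (hω _), or_false] at h1
  rw [eLpNorm_eq_zero_iff hF.aestronglyMeasurable hp0] at h1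
  exact h1

/-- On functions carried by finitely many cubes, the amalgam norm is controlled by `L^p`. -/
theorem exists_nnAmalgam_le_eLpNorm {p q : ℝ≥0∞} (hq0 : 0 < q) (hq : q < ∞) (ω : (ι → ℝ) → ℝ)
    (t : Finset (ι → ℤ)) :
    ∃ K : ℝ≥0∞, K ≠ ∞ ∧ ∀ F : (ι → ℝ) → ℝ≥0∞, (∀ k ∉ t, ∀ x ∈ cube k, F x = 0) →
      nnAmalgam p q ω F ≤ K * eLpNorm F p volume := by
  have hQ : 0 < q.toReal := ENNReal.toReal_pos hq0.ne' hq.ne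
  refine ⟨(∑ k ∈ t, ENNReal.ofReal (ω (latticePt k)) ^ q.toReal) ^ (1 / q.toReal), ?_, ?_⟩
  · refine ENNReal.rpow_ne_top_of_nonneg (by positivity) ?_
    exact ENNReal.sum_ne_top.2 fun k _ =>
      ENNReal.rpow_ne_top_of_nonneg hQ.le ENNReal.ofReal_ne_top
  · intro F hF
    unfold nnAmalgam
    rw [eLpNorm_eq_lintegral_rpow_enorm_toReal hq0.ne' hq.ne, lintegral_count]
    simp only [enorm_eq_self]
    have h0 : ∀ k ∉ t, (eLpNorm F p (volume.restrict (cube k)) *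
        ENNReal.ofReal (ω (latticePt k))) ^ q.toReal = 0 := by
      intro k hk
      have : eLpNorm F p (volume.restrict (cube k)) = 0 := by
        rw [eLpNorm_congr_ae (g := fun _ => (0 : ℝ≥0∞))]
        · exact eLpNorm_zero'
        · filter_upwards [ae_restrict_mem (measurableSet_cube k)] with x hx
          exact hF k hk x hx
      simp [this, hQ]
    rw [tsum_eq_sum (s := t) (fun k hk => h0 k hk)]
    calc _ ≤ (∑ k ∈ t, (ENNReal.ofReal (ω (latticePt k)) ^ q.toReal *
          eLpNorm F p volume ^ q.toReal)) ^ (1 / q.toReal) := by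
          gcongr with k hk
          rw [mul_comm, ENNReal.mul_rpow_of_nonneg _ _ hQ.le]
          gcongr
          exact Measure.restrict_le_self
      _ = _ := by
          rw [← Finset.sum_mul, ENNReal.mul_rpow_of_nonneg _ _ (by positivity), ← ENNReal.rpow_mul,
            mul_one_div_cancel hQ.ne', ENNReal.rpow_one]

/-- Functions in the amalgam space are approximated by their truncations to finitely many cubes. -/
theorem exists_nnAmalgam_indicator_compl_lt {p q : ℝ≥0∞} (hq0 : 0 < q) (hq : q < ∞)
    {ω : (ι → ℝ) → ℝ} {F : (ι → ℝ) → ℝ≥0∞} (h : nnAmalgam p q ω F < ∞) {ε : ℝ≥0∞} (hε : 0 < ε) :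
    ∃ t : Finset (ι → ℤ), nnAmalgam p q ω ((⋃ k ∈ t, cube k)ᶜ.indicator F) < ε := by
  have hQ : 0 < q.toReal := ENNReal.toReal_pos hq0.ne' hq.ne
  unfold nnAmalgam at h ⊢
  rw [eLpNorm_lt_top_iff_lintegral_rpow_enorm_lt_top hq0.ne' hq.ne, lintegral_count] at h
  simp only [eLpNorm_eq_lintegral_rpow_enorm_toReal hq0.ne' hq.ne, lintegral_count,
    enorm_eq_self] at h ⊢
  have hε' : 0 < ε ^ q.toReal := ENNReal.rpow_pos_of_nonneg hε hQ.le
  -- Finiteness of `q` enters here: the norm is a convergent series, and its tails are small.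
  obtain ⟨t, ht⟩ := ((tendsto_order.1 (ENNReal.tendsto_tsum_compl_atTop_zero h.ne)).2 _ hε').exists
  refine ⟨t, ?_⟩
  rw [one_div, ENNReal.rpow_inv_lt_iff hQ]
  refine lt_of_le_of_lt ?_ ht
  change _ ≤ ∑' k : {k | k ∉ t}, _
  rw [tsum_subtype {k | k ∉ t} (fun k => (eLpNorm F p (volume.restrict (cube k)) *
        ENNReal.ofReal (ω (latticePt k))) ^ q.toReal)]
  refine ENNReal.tsum_le_tsum fun k => ?_
  by_cases hk : k ∈ t
  · have : eLpNorm ((⋃ k ∈ t, cube k)ᶜ.indicator F) p (volume.restrict (cube k)) = 0 := by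
      rw [eLpNorm_congr_ae (g := fun _ => (0 : ℝ≥0∞))]
      · exact eLpNorm_zero'
      · filter_upwards [ae_restrict_mem (measurableSet_cube k)] with x hx
        refine Set.indicator_of_notMem ?_ _
        simp only [Set.mem_compl_iff, not_not]
        exact Set.mem_biUnion hk hx
    rw [this, zero_mul, ENNReal.zero_rpow_of_pos hQ]
    exact zero_le
  · rw [Set.indicator_of_mem (by exact hk)]
    gcongr ?_ ^ _
    gcongr ?_ * _
    refine eLpNorm_mono_enorm fun x => ?_
    simp only [enorm_eq_self]
    exact Set.indicator_le_self' (fun _ _ => zero_le) x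

end NNAmalgam

end WienerAmalgam

end

noncomputable section

namespace WienerAmalgam

/-! ### Twisted convolution with a general phase: symmetry, bilinearity, associativity -/

section Twisted

variable {d : ℕ}

/-- The normalizing constant of the twisted convolution. -/
def kappa (d : ℕ) : ℝ := (2 / Real.pi) ^ ((d : ℝ) / 2)

theorem kappa_pos (d : ℕ) : 0 < kappa d := by
  unfold kappa
  positivity

/-- The phase factor `e^{i θ σ(X, Y)}`. -/
def phase (θ : ℝ) (X Y : Phase d) : ℂ := Complex.exp (((θ * symp X Y : ℝ) : ℂ) * Complex.I)

theorem norm_phase (θ : ℝ) (X Y : Phase d) : ‖phase θ X Y‖ = 1 := Complex.norm_exp_ofReal_mul_I _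

theorem enorm_phase (θ : ℝ) (X Y : Phase d) : ‖phase θ X Y‖ₑ = 1 := by
  rw [← ofReal_norm, norm_phase, ENNReal.ofReal_one]

theorem continuous_phase (θ : ℝ) : Continuous fun z : Phase d × Phase d => phase θ z.1 z.2 := by
  have := continuous_symp (d := d)
  unfold phase
  fun_prop

theorem symp_self (X : Phase d) : symp X X = 0 := by simp [symp]

theorem symp_zero_right (X : Phase d) : symp X 0 = 0 := by simp [symp]

theorem symp_sub_left (X Y Z : Phase d) : symp (X - Y) Z = symp X Z - symp Y Z := by
  simp only [symp, Pi.sub_apply, mul_sub, sub_mul, Finset.sum_sub_distrib]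
  ring

theorem symp_sub_right (X Y Z : Phase d) : symp X (Y - Z) = symp X Y - symp X Z := by
  simp only [symp, Pi.sub_apply, mul_sub, sub_mul, Finset.sum_sub_distrib]
  ring

theorem symp_comm (X Y : Phase d) : symp X Y = -symp Y X := by
  simp only [symp, neg_sub]

/-- The cocycle identity for the phase, which is what makes the twisted product associative. -/
theorem phase_mul_phase (θ : ℝ) (X Y Z : Phase d) :
    phase θ (X - Z) (Y - Z) * phase θ X Z = phase θ X Y * phase θ Y Z := by
  unfold phase
  rw [← Complex.exp_add, ← Complex.exp_add, ← add_mul, ← add_mul, ← Complex.ofReal_add,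
    ← Complex.ofReal_add, symp_sub_left, symp_sub_right, symp_sub_right, symp_self, symp_comm Z Y]
  congr 3
  ring

/-- The twisted convolution with the phase factor `e^{i θ σ(X, Y)}`. -/
def tcFun (θ : ℝ) (a b : Phase d → ℂ) (X : Phase d) : ℂ :=
  (kappa d : ℂ) * ∫ Y, a (X - Y) * b Y * phase θ X Y

theorem twistedIntegrand_eq (a b : Phase d → ℂ) (X Y : Phase d) :
    twistedIntegrand a b X Y = a (X - Y) * b Y * phase 2 X Y := by
  unfold twistedIntegrand phase
  congr 2
  push_cast
  ring

theorem twistedConvFun_eq (a b : Phase d → ℂ) : twistedConvFun a b = tcFun 2 a b := by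
  funext X
  simp only [twistedConvFun, tcFun, twistedIntegrand_eq, kappa]

theorem stronglyMeasurable_tcFun (θ : ℝ) {a b : Phase d → ℂ} (ha : StronglyMeasurable a)
    (hb : StronglyMeasurable b) : StronglyMeasurable (tcFun θ a b) := by
  have h1 : StronglyMeasurable (fun z : Phase d × Phase d =>
      a (z.1 - z.2) * b z.2 * phase θ z.1 z.2) :=
    ((ha.comp_measurable (by fun_prop)).mul (hb.comp_measurable (by fun_prop))).mul
      (continuous_phase θ).stronglyMeasurable
  exact h1.integral_prod_right'.const_mul _

/-- The absolute value of a function, as an `ℝ≥0∞`-valued function. -/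
def eabs (a : Phase d → ℂ) (X : Phase d) : ℝ≥0∞ := ‖a X‖ₑ

theorem measurable_eabs {a : Phase d → ℂ} (ha : StronglyMeasurable a) : Measurable (eabs a) :=
  ha.enorm

theorem enorm_tcFun_le (θ : ℝ) (a b : Phase d → ℂ) (X : Phase d) :
    ‖tcFun θ a b X‖ₑ ≤ ENNReal.ofReal (kappa d) * nnConv (eabs a) (eabs b) X := by
  unfold tcFun
  rw [enorm_mul, nnConv_comm]
  gcongr
  · rw [← ofReal_norm, Complex.norm_of_nonneg (kappa_pos d).le]
  · refine (enorm_integral_le_lintegral_enorm _).trans (le_of_eq ?_)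
    refine lintegral_congr fun Y => ?_
    rw [enorm_mul, enorm_mul, enorm_phase, mul_one, mul_comm]
    rfl

theorem integrable_tcFun (θ : ℝ) {a b : Phase d → ℂ} (ha : StronglyMeasurable a)
    (hb : StronglyMeasurable b) {X : Phase d} (h : nnConv (eabs a) (eabs b) X < ∞) :
    Integrable fun Y => a (X - Y) * b Y * phase θ X Y := by
  have hm : StronglyMeasurable fun Y => a (X - Y) * b Y * phase θ X Y :=
    ((ha.comp_measurable (by fun_prop)).mul hb).mul
      ((continuous_phase θ).comp (by fun_prop : Continuous fun Y => (X, Y))).stronglyMeasurable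
  refine ⟨hm.aestronglyMeasurable, ?_⟩
  rw [hasFiniteIntegral_iff_enorm]
  refine lt_of_eq_of_lt ?_ h
  rw [nnConv_comm]
  refine lintegral_congr fun Y => ?_
  rw [enorm_mul, enorm_mul, enorm_phase, mul_one, mul_comm]
  rfl

/-- Substitute `Y ↦ X - Y` and use `σ(X, X - Y) = -σ(X, Y)`. This reduces every statement about
right multiplication to one about left multiplication. -/
theorem tcFun_swap (θ : ℝ) (a b : Phase d → ℂ) : tcFun θ a b = tcFun (-θ) b a := by
  funext X
  unfold tcFun
  rw [← integral_sub_left_eq_self (fun Y => a (X - Y) * b Y * phase θ X Y) volume X]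
  congr 2
  funext Y
  have : phase θ X (X - Y) = phase (-θ) X Y := by
    unfold phase
    rw [symp_sub_right, symp_self]
    congr 3
    ring
  rw [this, sub_sub_cancel, mul_comm (a Y)]

theorem tcFun_congr (θ : ℝ) {a a' b b' : Phase d → ℂ} (ha : a =ᵐ[volume] a')
    (hb : b =ᵐ[volume] b') : tcFun θ a b = tcFun θ a' b' := by
  funext X
  unfold tcFun
  congr 1
  refine integral_congr_ae ?_
  have h1 : (fun Y => a (X - Y)) =ᵐ[volume] fun Y => a' (X - Y) :=
    (quasiMeasurePreserving_sub_left volume X).ae_eq ha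
  filter_upwards [h1, hb] with Y h1 h2
  rw [h1, h2]

/-- Fubini, justified by the finite triple absolute convolution, after the shift `Y ↦ Y - Z` and the
cocycle identity. -/
theorem tcFun_assoc (θ : ℝ) {a b g : Phase d → ℂ} (ha : StronglyMeasurable a)
    (hb : StronglyMeasurable b) (hg : StronglyMeasurable g) {X : Phase d}
    (h : nnConv (eabs a) (nnConv (eabs b) (eabs g)) X < ∞) :
    tcFun θ (tcFun θ a b) g X = tcFun θ a (tcFun θ b g) X := by
  set H : Phase d → Phase d → ℂ := fun Y Z =>
    a (X - Y) * phase θ X Y * (b (Y - Z) * g Z * phase θ Y Z) with hH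
  have hHm : StronglyMeasurable (Function.uncurry H) := by
    have h1 : StronglyMeasurable fun z : Phase d × Phase d => a (X - z.1) :=
      ha.comp_measurable (by fun_prop)
    have h2 : StronglyMeasurable fun z : Phase d × Phase d => b (z.1 - z.2) :=
      hb.comp_measurable (by fun_prop)
    have h3 : StronglyMeasurable fun z : Phase d × Phase d => g z.2 :=
      hg.comp_measurable (by fun_prop)
    have h4 : StronglyMeasurable fun z : Phase d × Phase d => phase θ X z.1 :=
      ((continuous_phase θ).comp
        (by fun_prop : Continuous fun z : Phase d × Phase d => (X, z.1))).stronglyMeasurable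
    exact (h1.mul h4).mul ((h2.mul h3).mul (continuous_phase θ).stronglyMeasurable)
  have hHi : Integrable (Function.uncurry H) (volume.prod volume) := by
    refine ⟨hHm.aestronglyMeasurable, ?_⟩
    rw [hasFiniteIntegral_iff_enorm, lintegral_prod _ hHm.enorm.aemeasurable]
    refine lt_of_eq_of_lt ?_ h
    rw [nnConv_comm]
    refine lintegral_congr fun Y => ?_
    rw [nnConv_comm, mul_comm]
    unfold nnConv
    rw [← lintegral_const_mul _ (by
      have := measurable_eabs hb
      have := measurable_eabs hg
      fun_prop)]
    refine lintegral_congr fun Z => ?_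
    simp only [hH, Function.uncurry, enorm_mul, enorm_phase, mul_one, eabs]
    ring
  have e1 : tcFun θ a (tcFun θ b g) X = (kappa d : ℂ) * ((kappa d : ℂ) * ∫ Y, ∫ Z, H Y Z) := by
    unfold tcFun
    congr 1
    rw [← integral_const_mul]
    refine integral_congr_ae (Filter.Eventually.of_forall fun Y => ?_)
    simp only [hH]
    rw [integral_const_mul]
    ring
  have e2 : tcFun θ (tcFun θ a b) g X = (kappa d : ℂ) * ((kappa d : ℂ) * ∫ Z, ∫ Y, H Y Z) := by
    unfold tcFun
    congr 1
    rw [← integral_const_mul]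
    refine integral_congr_ae (Filter.Eventually.of_forall fun Z => ?_)
    simp only
    rw [← integral_sub_right_eq_self
      (fun Y => a (X - Z - Y) * b Y * phase θ (X - Z) Y) Z, mul_assoc, mul_assoc,
      ← integral_mul_const]
    congr 1
    refine integral_congr_ae (Filter.Eventually.of_forall fun Y => ?_)
    simp only [hH]
    have hX : X - Z - (Y - Z) = X - Y := by abel
    rw [hX]
    linear_combination (a (X - Y) * b (Y - Z) * g Z) * phase_mul_phase θ X Y Z
  rw [e1, e2, integral_integral_swap hHi]

/-- The twisted convolution with phase `e^{i θ σ(X, Y)}` on classes of measurable functions. -/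
def tc (θ : ℝ) (a b : Phase d →ₘ[volume] ℂ) : Phase d →ₘ[volume] ℂ :=
  AEEqFun.mk (tcFun θ a b)
    (stronglyMeasurable_tcFun θ a.stronglyMeasurable b.stronglyMeasurable).aestronglyMeasurable

theorem coeFn_tc (θ : ℝ) (a b : Phase d →ₘ[volume] ℂ) : tc θ a b =ᵐ[volume] tcFun θ a b :=
  AEEqFun.coeFn_mk _ _

theorem twistedConv_eq_tc (a b : Phase d →ₘ[volume] ℂ) : twistedConv a b = tc 2 a b := by
  ext1
  refine (AEEqFun.coeFn_mk _ _).trans ?_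
  rw [twistedConvFun_eq]
  exact (coeFn_tc 2 a b).symm

theorem tc_swap (θ : ℝ) (a b : Phase d →ₘ[volume] ℂ) : tc θ a b = tc (-θ) b a := by
  ext1
  refine (coeFn_tc θ a b).trans ?_
  rw [tcFun_swap]
  exact (coeFn_tc _ b a).symm

/-- Absolute convergence almost everywhere of the convolution integrals. -/
def AbsConv (a b : Phase d →ₘ[volume] ℂ) : Prop :=
  ∀ᵐ X, nnConv (eabs a) (eabs b) X < ∞

theorem AbsConv.symm {a b : Phase d →ₘ[volume] ℂ} (h : AbsConv a b) : AbsConv b a := by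
  unfold AbsConv
  rw [nnConv_comm]
  exact h

theorem AbsConv.twistedConvExists {a b : Phase d →ₘ[volume] ℂ} (h : AbsConv a b) :
    TwistedConvExists (a : Phase d → ℂ) b := by
  filter_upwards [h] with X hX
  simpa only [funext (twistedIntegrand_eq a b X)] using
    integrable_tcFun 2 a.stronglyMeasurable b.stronglyMeasurable hX

theorem tc_add_right (θ : ℝ) {a f g : Phase d →ₘ[volume] ℂ} (hf : AbsConv a f) (hg : AbsConv a g) :
    tc θ a (f + g) = tc θ a f + tc θ a g := by
  ext1
  refine (coeFn_tc _ _ _).trans ?_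
  rw [tcFun_congr θ (Filter.EventuallyEq.refl _ _) (AEEqFun.coeFn_add f g)]
  filter_upwards [hf, hg, coeFn_tc θ a f, coeFn_tc θ a g, AEEqFun.coeFn_add (tc θ a f) (tc θ a g)]
    with X h1 h2 h3 h4 h5
  rw [h5, Pi.add_apply, h3, h4]
  unfold tcFun
  rw [← mul_add, ← integral_add
    (integrable_tcFun θ a.stronglyMeasurable f.stronglyMeasurable h1)
    (integrable_tcFun θ a.stronglyMeasurable g.stronglyMeasurable h2)]
  congr 2
  funext Y
  simp only [Pi.add_apply]
  ring

theorem tc_add_left (θ : ℝ) {a b f : Phase d →ₘ[volume] ℂ} (ha : AbsConv a f) (hb : AbsConv b f) :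
    tc θ (a + b) f = tc θ a f + tc θ b f := by
  rw [tc_swap, tc_add_right _ ha.symm hb.symm, tc_swap θ a, tc_swap θ b]

theorem tc_smul_right (θ : ℝ) (a f : Phase d →ₘ[volume] ℂ) (c : ℝ) :
    tc θ a (c • f) = c • tc θ a f := by
  ext1
  refine (coeFn_tc _ _ _).trans ?_
  rw [tcFun_congr θ (Filter.EventuallyEq.refl _ _) (AEEqFun.coeFn_smul c f)]
  filter_upwards [coeFn_tc θ a f, AEEqFun.coeFn_smul c (tc θ a f)] with X h3 h5
  rw [h5, Pi.smul_apply, h3]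
  unfold tcFun
  rw [Complex.real_smul, mul_left_comm, ← integral_const_mul (c : ℂ)]
  congr 2
  funext Y
  simp only [Pi.smul_apply, Complex.real_smul]
  ring

theorem tc_smul_left (θ : ℝ) (a f : Phase d →ₘ[volume] ℂ) (c : ℝ) :
    tc θ (c • a) f = c • tc θ a f := by
  rw [tc_swap, tc_smul_right, ← tc_swap]

theorem tc_zero_left (θ : ℝ) (f : Phase d →ₘ[volume] ℂ) : tc θ 0 f = 0 := by
  have h0 : (0 : ℝ) • (0 : Phase d →ₘ[volume] ℂ) = 0 :=
    zero_smul ℝ (0 : Phase d →ₘ[volume] ℂ)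
  have h := tc_smul_left θ 0 f 0
  rw [h0] at h
  exact h.trans (zero_smul ℝ (tc θ 0 f))

theorem tc_assoc (θ : ℝ) {a b g : Phase d →ₘ[volume] ℂ}
    (h : ∀ᵐ X, nnConv (eabs a) (nnConv (eabs b) (eabs g)) X < ∞) :
    tc θ (tc θ a b) g = tc θ a (tc θ b g) := by
  ext1
  refine (coeFn_tc _ _ _).trans (Filter.EventuallyEq.trans ?_ (coeFn_tc _ _ _).symm)
  rw [tcFun_congr θ (coeFn_tc θ a b) (Filter.EventuallyEq.refl _ _),
    tcFun_congr θ (Filter.EventuallyEq.refl _ _) (coeFn_tc θ b g)]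
  filter_upwards [h] with X hX
  exact tcFun_assoc θ a.stronglyMeasurable b.stronglyMeasurable g.stronglyMeasurable hX

end Twisted

end WienerAmalgam

end

noncomputable section

namespace WienerAmalgam

open Filter Topology

/-! ### The approximate identity in `L^p` -/

section Box

variable {d : ℕ}

/-- The cube `[0, δ]^{2d}`. -/
def boxSet (d : ℕ) (δ : ℝ) : Set (Phase d) := Set.Icc 0 (fun _ => δ)

theorem measurableSet_boxSet (δ : ℝ) : MeasurableSet (boxSet d δ) := measurableSet_Icc

theorem volume_boxSet (δ : ℝ) :
    volume (boxSet d δ) = ∏ _i : Fin d ⊕ Fin d, ENNReal.ofReal δ := by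
  simp [boxSet, Real.volume_Icc_pi]

theorem volume_boxSet_ne_top (δ : ℝ) : volume (boxSet d δ) ≠ ∞ := by
  rw [volume_boxSet]
  exact ENNReal.prod_ne_top fun _ _ => ENNReal.ofReal_ne_top

theorem volume_boxSet_ne_zero {δ : ℝ} (hδ : 0 < δ) : volume (boxSet d δ) ≠ 0 := by
  rw [volume_boxSet]
  exact Finset.prod_ne_zero_iff.2 fun _ _ => by simpa using hδ

/-- The approximate identity for twisted convolution: normalized indicator functions of cubes. -/
def boxFun (d : ℕ) (δ : ℝ) : Phase d → ℂ :=
  (boxSet d δ).indicator fun _ => (((kappa d)⁻¹ * (volume.real (boxSet d δ))⁻¹ : ℝ) : ℂ)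

theorem stronglyMeasurable_boxFun (δ : ℝ) : StronglyMeasurable (boxFun d δ) :=
  stronglyMeasurable_const.indicator (measurableSet_boxSet δ)

/-- Independence of `δ` gives all operator bounds below uniformly along the approximate identity. -/
theorem lintegral_eabs_boxFun {δ : ℝ} (hδ : 0 < δ) :
    ∫⁻ X, eabs (boxFun d δ) X = ENNReal.ofReal (kappa d)⁻¹ := by
  have hv : 0 < volume.real (boxSet d δ) :=
    ENNReal.toReal_pos (volume_boxSet_ne_zero hδ) (volume_boxSet_ne_top δ)
  have hk := kappa_pos d
  simp only [eabs, boxFun, enorm_indicator_eq_indicator_enorm]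
  rw [lintegral_indicator_const (measurableSet_boxSet δ), ← ofReal_norm,
    Complex.norm_of_nonneg (by positivity), ENNReal.ofReal_mul (by positivity), mul_assoc,
    ENNReal.ofReal_inv_of_pos hv, Measure.real, ENNReal.ofReal_toReal (volume_boxSet_ne_top δ),
    ENNReal.inv_mul_cancel (volume_boxSet_ne_zero hδ) (volume_boxSet_ne_top δ), mul_one]

theorem tcFun_boxFun (θ : ℝ) (h : Phase d → ℂ) (δ : ℝ) (X : Phase d) :
    tcFun θ h (boxFun d δ) X = ⨍ Y in boxSet d δ, h (X - Y) * phase θ X Y := by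
  have hk := (kappa_pos d).ne'
  rw [setAverage_eq, ← integral_smul, ← integral_indicator (measurableSet_boxSet δ)]
  unfold tcFun
  rw [← integral_const_mul]
  congr 1
  funext Y
  by_cases hY : Y ∈ boxSet d δ
  · rw [boxFun, Set.indicator_of_mem hY, Set.indicator_of_mem hY, Complex.real_smul]
    push_cast
    have : (kappa d : ℂ) ≠ 0 := by exact_mod_cast hk
    field_simp
  · rw [boxFun, Set.indicator_of_notMem hY, Set.indicator_of_notMem hY]
    simp

theorem norm_setAverage_sub_le {s : Set (Phase d)} (hs : MeasurableSet s) (hs0 : volume s ≠ 0)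
    (hst : volume s ≠ ∞) {g : Phase d → ℂ} (hg : IntegrableOn g s) (c : ℂ) {ε : ℝ}
    (h : ∀ y ∈ s, ‖g y - c‖ ≤ ε) : ‖(⨍ y in s, g y) - c‖ ≤ ε := by
  have h1 : (⨍ y in s, g y) ∈ Metric.closedBall c ε := by
    refine (convex_closedBall c ε).set_average_mem Metric.isClosed_closedBall hs0 hst ?_ hg
    filter_upwards [ae_restrict_mem hs] with y hy
    simpa [dist_eq_norm] using h y hy
  simpa [dist_eq_norm] using h1

theorem boxSet_subset_closedBall {δ : ℝ} (hδ : 0 ≤ δ) :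
    boxSet d δ ⊆ Metric.closedBall 0 δ := by
  intro Y hY
  rw [mem_closedBall_zero_iff, pi_norm_le_iff_of_nonneg hδ]
  intro i
  rw [Real.norm_of_nonneg (hY.1 i)]
  exact hY.2 i

/-- The expression vanishes at `Y = 0`, where the phase is `1`; the tube lemma makes this uniform
over the compact set `K`. Compactness matters because the phase oscillates faster as `X` grows. -/
theorem exists_uniform_phase_bound (θ : ℝ) {h : Phase d → ℂ} (hc : Continuous h)
    {K : Set (Phase d)} (hK : IsCompact K) {ε : ℝ} (hε : 0 < ε) :
    ∀ᶠ δ in 𝓝[>] (0 : ℝ), ∀ X ∈ K, ∀ Y ∈ boxSet d δ, ‖h (X - Y) * phase θ X Y - h X‖ < ε := by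
  have hG : Continuous fun z : Phase d × Phase d => ‖h (z.2 - z.1) * phase θ z.2 z.1 - h z.2‖ := by
    have := (continuous_phase (d := d) θ).comp continuous_swap
    simp only [Function.comp_def, Prod.fst_swap, Prod.snd_swap] at this
    fun_prop
  have hO : IsOpen {z : Phase d × Phase d | ‖h (z.2 - z.1) * phase θ z.2 z.1 - h z.2‖ < ε} :=
    isOpen_lt hG continuous_const
  obtain ⟨u, w, hu, -, h0u, hKw, huw⟩ := generalized_tube_lemma (isCompact_singleton (x := (0 : Phase d)))
    hK hO (by
      rintro ⟨Y, X⟩ ⟨hY, -⟩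
      rw [Set.mem_singleton_iff] at hY
      simp only at hY
      simp [hY, phase, symp_zero_right, hε])
  obtain ⟨δ₀, hδ₀, hball⟩ := Metric.isOpen_iff.1 hu 0 (h0u rfl)
  filter_upwards [Ioo_mem_nhdsGT hδ₀] with δ hδ X hX Y hY
  refine huw (Set.mk_mem_prod (hball ?_) (hKw hX))
  exact Metric.closedBall_subset_ball hδ.2 (boxSet_subset_closedBall hδ.1.le hY)

open scoped Pointwise in
theorem tendsto_eLpNorm_tcFun_boxFun_of_hasCompactSupport (θ : ℝ) {h : Phase d → ℂ}
    (hc : Continuous h) (hs : HasCompactSupport h) {p : ℝ≥0∞} :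
    Tendsto (fun δ => eLpNorm (tcFun θ h (boxFun d δ) - h) p volume) (𝓝[>] 0) (𝓝 0) := by
  set K : Set (Phase d) := tsupport h + Metric.closedBall (0 : Phase d) 1 with hKdef
  have hK : IsCompact K := hs.isCompact.add (isCompact_closedBall 0 1)
  have hKfin : volume K ^ (1 / p.toReal) ≠ ∞ :=
    ENNReal.rpow_ne_top_of_nonneg (by positivity) hK.measure_lt_top.ne
  rw [ENNReal.tendsto_nhds_zero]
  intro ε hε
  obtain ⟨η, hη0, hη⟩ : ∃ η : ℝ, 0 < η ∧ ENNReal.ofReal η * volume K ^ (1 / p.toReal) ≤ ε := by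
    have h1 : Tendsto (fun η : ℝ => ENNReal.ofReal η * volume K ^ (1 / p.toReal)) (𝓝[>] 0) (𝓝 0) := by
      have h2 : Tendsto (fun η : ℝ => ENNReal.ofReal η) (𝓝[>] 0) (𝓝 0) := by
        simpa using (ENNReal.continuous_ofReal.tendsto 0).mono_left nhdsWithin_le_nhds
      simpa using ENNReal.Tendsto.mul_const h2 (Or.inr hKfin)
    obtain ⟨η, h3, h4⟩ := ((ENNReal.tendsto_nhds_zero.1 h1 ε hε).and self_mem_nhdsWithin).exists
    exact ⟨η, h4, h3⟩
  filter_upwards [exists_uniform_phase_bound θ hc hK hη0, Ioo_mem_nhdsGT (zero_lt_one' ℝ)]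
    with δ h1 hδ
  have hint : ∀ X, IntegrableOn (fun Y => h (X - Y) * phase θ X Y) (boxSet d δ) := by
    intro X
    have : Continuous fun Y => phase θ X Y :=
      (continuous_phase θ).comp (by fun_prop : Continuous fun Y => (X, Y))
    exact ContinuousOn.integrableOn_compact isCompact_Icc
      (by fun_prop : Continuous fun Y => h (X - Y) * phase θ X Y).continuousOn
  have hpt : ∀ X, ‖(tcFun θ h (boxFun d δ) - h) X‖ₑ
      ≤ ‖K.indicator (fun _ => ENNReal.ofReal η) X‖ₑ := by
    intro X
    rw [Pi.sub_apply, tcFun_boxFun, enorm_eq_self, ← ofReal_norm]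
    by_cases hX : X ∈ K
    · rw [Set.indicator_of_mem hX]
      exact ENNReal.ofReal_le_ofReal (norm_setAverage_sub_le (measurableSet_boxSet δ)
        (volume_boxSet_ne_zero hδ.1) (volume_boxSet_ne_top δ) (hint X) _
        fun Y hY => (h1 X hX Y hY).le)
    · rw [Set.indicator_of_notMem hX]
      refine (ENNReal.ofReal_le_ofReal (norm_setAverage_sub_le (measurableSet_boxSet δ)
        (volume_boxSet_ne_zero hδ.1) (volume_boxSet_ne_top δ) (hint X) _
        (ε := 0) fun Y hY => ?_)).trans (by simp)
      have hY1 : Y ∈ Metric.closedBall (0 : Phase d) 1 :=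
        Metric.closedBall_subset_closedBall hδ.2.le (boxSet_subset_closedBall hδ.1.le hY)
      have e1 : h (X - Y) = 0 := by
        refine image_eq_zero_of_notMem_tsupport fun hcon => hX ?_
        exact ⟨X - Y, hcon, Y, hY1, by simp⟩
      have e2 : h X = 0 := by
        refine image_eq_zero_of_notMem_tsupport fun hcon => hX ?_
        exact ⟨X, hcon, 0, by simp, by simp⟩
      simp [e1, e2]
  refine (eLpNorm_mono_enorm hpt).trans ((eLpNorm_indicator_const_le _ _).trans ?_)
  simpa using hη

theorem eLpNorm_tcFun_le (θ : ℝ) {a b : Phase d → ℂ} (ha : StronglyMeasurable a)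
    (hb : StronglyMeasurable b) {p : ℝ≥0∞} (hp1 : 1 ≤ p) (hp : p < ∞) :
    eLpNorm (tcFun θ a b) p volume
      ≤ ENNReal.ofReal (kappa d) * ((∫⁻ Y, eabs a Y) * eLpNorm b p volume) := by
  calc _ ≤ eLpNorm (fun X => ENNReal.ofReal (kappa d) * nnConv (eabs a) (eabs b) X) p volume :=
        eLpNorm_mono_enorm fun X => by simpa using enorm_tcFun_le θ a b X
    _ = ENNReal.ofReal (kappa d) * eLpNorm (nnConv (eabs a) (eabs b)) p volume :=
        eLpNorm_const_mul_ennreal (zero_lt_one.trans_le hp1).ne' hp.ne _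
          (measurable_nnConv (measurable_eabs ha) (measurable_eabs hb)).aemeasurable
    _ ≤ _ := by
        refine mul_le_mul_right ?_ _
        refine (eLpNorm_nnConv_le (measurable_eabs ha) (measurable_eabs hb) hp1 hp).trans ?_
        rw [← eLpNorm_enorm b]
        rfl

theorem ae_nnConv_lt_top_of_memLp {a b : Phase d → ℂ} (ha : StronglyMeasurable a)
    (hb : StronglyMeasurable b) {p : ℝ≥0∞} (hp1 : 1 ≤ p) (hp : p < ∞)
    (ha1 : ∫⁻ Y, eabs a Y ≠ ∞) (hbp : eLpNorm b p volume ≠ ∞) :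
    ∀ᵐ X, nnConv (eabs a) (eabs b) X < ∞ := by
  have hp0 := (zero_lt_one.trans_le hp1).ne'
  have hP : 0 < p.toReal := ENNReal.toReal_pos hp0 hp.ne
  have hm := measurable_nnConv (measurable_eabs ha) (measurable_eabs hb)
  have h1 : eLpNorm (nnConv (eabs a) (eabs b)) p volume < ∞ := by
    refine (eLpNorm_nnConv_le (measurable_eabs ha) (measurable_eabs hb) hp1 hp).trans_lt ?_
    refine ENNReal.mul_lt_top ha1.lt_top ?_
    rw [← eLpNorm_enorm b] at hbp
    exact hbp.lt_top
  rw [eLpNorm_lt_top_iff_lintegral_rpow_enorm_lt_top hp0 hp.ne] at h1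
  filter_upwards [ae_lt_top (by fun_prop) h1.ne] with x hx
  by_contra hcon
  rw [not_lt, top_le_iff] at hcon
  simp [hcon, hP] at hx

theorem tcFun_add_right_apply (θ : ℝ) {a f g : Phase d → ℂ} (ha : StronglyMeasurable a)
    (hf : StronglyMeasurable f) (hg : StronglyMeasurable g) {X : Phase d}
    (h1 : nnConv (eabs a) (eabs f) X < ∞) (h2 : nnConv (eabs a) (eabs g) X < ∞) :
    tcFun θ a (f + g) X = tcFun θ a f X + tcFun θ a g X := by
  unfold tcFun
  rw [← mul_add, ← integral_add (integrable_tcFun θ ha hf h1) (integrable_tcFun θ ha hg h2)]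
  congr 2
  funext Y
  simp only [Pi.add_apply]
  ring

/-- Approximate `f` by a compactly supported continuous `h`; Young's inequality makes convolution
with a box a contraction on `L^p`, so three errors of size `ε / 3` suffice. -/
theorem tendsto_eLpNorm_boxFun_tcFun (θ : ℝ) {f : Phase d → ℂ} (hfm : StronglyMeasurable f)
    {p : ℝ≥0∞} (hp1 : 1 ≤ p) (hp : p < ∞) (hf : MemLp f p volume) :
    Tendsto (fun δ => eLpNorm (tcFun θ (boxFun d δ) f - f) p volume) (𝓝[>] 0) (𝓝 0) := by
  rw [ENNReal.tendsto_nhds_zero]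
  intro ε hε
  have hε3 : 0 < ε / 3 := ENNReal.div_pos hε.ne' (by simp)
  obtain ⟨h, hs, hfh, hc, hhp⟩ := hf.exists_hasCompactSupport_eLpNorm_sub_le hp.ne hε3.ne'
  have hconv := ENNReal.tendsto_nhds_zero.1
    (tendsto_eLpNorm_tcFun_boxFun_of_hasCompactSupport (-θ) hc hs (p := p)) _ hε3
  filter_upwards [hconv, self_mem_nhdsWithin] with δ h1 hδ
  rw [← tcFun_swap] at h1
  have hb := stronglyMeasurable_boxFun (d := d) δ
  have hb1 : ∫⁻ X, eabs (boxFun d δ) X ≠ ∞ := by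
    rw [lintegral_eabs_boxFun hδ]
    exact ENNReal.ofReal_ne_top
  have hhm : StronglyMeasurable h := hc.stronglyMeasurable
  have hfhm : StronglyMeasurable (f - h) := hfm.sub hhm
  have e : tcFun θ (boxFun d δ) f - f =ᵐ[volume]
      tcFun θ (boxFun d δ) (f - h) + (tcFun θ (boxFun d δ) h - h) - (f - h) := by
    filter_upwards [ae_nnConv_lt_top_of_memLp hb hfhm hp1 hp hb1 (hf.sub hhp).eLpNorm_ne_top,
      ae_nnConv_lt_top_of_memLp hb hhm hp1 hp hb1 hhp.eLpNorm_ne_top] with X h2 h3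
    have h4 := tcFun_add_right_apply θ hb hfhm hhm h2 h3
    rw [sub_add_cancel] at h4
    simp only [Pi.sub_apply, Pi.add_apply, h4]
    ring
  rw [eLpNorm_congr_ae e]
  have m1 := (stronglyMeasurable_tcFun θ hb hfhm).aestronglyMeasurable (μ := volume)
  have m2 := ((stronglyMeasurable_tcFun θ hb hhm).sub hhm).aestronglyMeasurable (μ := volume)
  refine (eLpNorm_sub_le (m1.add m2) hfhm.aestronglyMeasurable hp1).trans ?_
  have h5 : eLpNorm (tcFun θ (boxFun d δ) (f - h)) p volume ≤ ε / 3 := by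
    refine (eLpNorm_tcFun_le θ hb hfhm hp1 hp).trans ?_
    rw [lintegral_eabs_boxFun hδ, ← mul_assoc, ← ENNReal.ofReal_mul (kappa_pos d).le,
      mul_inv_cancel₀ (kappa_pos d).ne', ENNReal.ofReal_one, one_mul]
    exact hfh
  calc _ ≤ (ε / 3 + ε / 3) + ε / 3 :=
        add_le_add ((eLpNorm_add_le m1 m2 hp1).trans (add_le_add h5 h1)) hfh
    _ = ε := ENNReal.add_thirds ε

end Box

end WienerAmalgam

end

/-! ### The approximate identity in the amalgam space -/

noncomputable section

namespace WienerAmalgam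

open Filter Topology

/-- The standing assumptions on exponents and weights. -/
structure Admissible (ι : Type) [Fintype ι] (p q r : ℝ≥0∞) (ω v : (ι → ℝ) → ℝ) : Prop where
  r_pos : 0 < r
  r_le_one : r ≤ 1
  one_le_p : 1 ≤ p
  p_lt_top : p < ∞
  r_le_q : r ≤ q
  q_lt_top : q < ∞
  weight_pos : ∀ x, 0 < ω x
  mem_moderateWeights : v ∈ moderateWeights ι
  moderate : IsModerateWrt ω v

namespace Admissible

section General

variable {ι : Type} [Fintype ι] {p q r : ℝ≥0∞} {ω v : (ι → ℝ) → ℝ}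

theorem r_ne_top (H : Admissible ι p q r ω v) : r ≠ ∞ := (H.r_le_one.trans_lt ENNReal.one_lt_top).ne

theorem q_pos (H : Admissible ι p q r ω v) : 0 < q := H.r_pos.trans_le H.r_le_q

theorem toReal_r_pos (H : Admissible ι p q r ω v) : 0 < r.toReal :=
  ENNReal.toReal_pos H.r_pos.ne' H.r_ne_top

theorem rpow_lt_top_iff (H : Admissible ι p q r ω v) {x : ℝ≥0∞} : x ^ r.toReal < ∞ ↔ x < ∞ :=
  ENNReal.rpow_lt_top_iff_of_pos H.toReal_r_pos

theorem exists_conv_bound (H : Admissible ι p q r ω v) :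
    ∃ K : ℝ≥0∞, K ≠ ∞ ∧ ∀ A F : (ι → ℝ) → ℝ≥0∞, Measurable A → Measurable F →
      nnAmalgam p q ω (nnConv A F) ^ r.toReal
        ≤ K * (nnAmalgam 1 r v A ^ r.toReal * nnAmalgam p q ω F ^ r.toReal) :=
  exists_nnAmalgam_nnConv_rpow_le H.r_pos H.r_le_one H.one_le_p H.p_lt_top H.r_le_q H.q_lt_top
    H.weight_pos H.mem_moderateWeights H.moderate

theorem nnConv_lt_top (H : Admissible ι p q r ω v) {A F : (ι → ℝ) → ℝ≥0∞} (hA : Measurable A)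
    (hF : Measurable F) (hA1 : nnAmalgam 1 r v A < ∞) (hF1 : nnAmalgam p q ω F < ∞) :
    nnAmalgam p q ω (nnConv A F) < ∞ := by
  obtain ⟨K, hK, h⟩ := H.exists_conv_bound
  rw [← H.rpow_lt_top_iff] at hA1 hF1 ⊢
  exact (h A F hA hF).trans_lt (ENNReal.mul_lt_top hK.lt_top (ENNReal.mul_lt_top hA1 hF1))

theorem ae_lt_top (H : Admissible ι p q r ω v) {F : (ι → ℝ) → ℝ≥0∞} (hF : Measurable F)
    (h : nnAmalgam p q ω F < ∞) : ∀ᵐ x, F x < ∞ :=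
  ae_lt_top_of_nnAmalgam_lt_top H.one_le_p H.p_lt_top H.q_pos H.q_lt_top H.weight_pos hF h

theorem add_rpow_le (H : Admissible ι p q r ω v) {F G : (ι → ℝ) → ℝ≥0∞} (hF : Measurable F)
    (hG : Measurable G) : nnAmalgam p q ω (fun x => F x + G x) ^ r.toReal
      ≤ nnAmalgam p q ω F ^ r.toReal + nnAmalgam p q ω G ^ r.toReal :=
  nnAmalgam_add_rpow_le H.r_pos H.r_le_one H.one_le_p H.p_lt_top H.r_le_q H.q_lt_top ω hF hG

theorem mem_neighbors_of_mem_Icc {k : ι → ℤ} {x : ι → ℝ} (hx : x ∈ cube k)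
    (h1 : x ∈ Set.Icc (0 : ι → ℝ) 1) : k ∈ neighbors ι := by
  rw [mem_neighbors]
  refine ⟨fun i => ?_, fun i => ?_⟩
  · have h2 : (x i : ℝ) ≤ k i + 1 := hx.2 i
    have h3 : (0 : ℝ) ≤ x i := h1.1 i
    have h4 : ((-1 : ℤ) : ℝ) ≤ k i := by
      push_cast
      linarith
    exact Int.cast_le.1 h4
  · have h2 : (k i : ℝ) ≤ x i := hx.1 i
    have h3 : x i ≤ 1 := h1.2 i
    have h4 : (k i : ℝ) ≤ ((1 : ℤ) : ℝ) := by
      push_cast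
      linarith
    exact Int.cast_le.1 h4

/-- Only the finitely many cubes in `neighbors` meet the unit cube, so the `ℓ^r` sum costs a
constant. This lets `L¹` replace the `(1, r)` amalgam norm for left factors. -/
theorem exists_unit_amalgam_bound (H : Admissible ι p q r ω v) :
    ∃ K : ℝ≥0∞, K ≠ ∞ ∧ ∀ A : (ι → ℝ) → ℝ≥0∞,
      (∀ᵐ x, x ∉ Set.Icc (0 : ι → ℝ) 1 → A x = 0) → nnAmalgam 1 r v A ≤ K * ∫⁻ x, A x := by
  obtain ⟨K, hK, h⟩ := exists_nnAmalgam_le_eLpNorm (p := 1) H.r_pos H.r_ne_top.lt_top v (neighbors ι)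
  refine ⟨K, hK, fun A hA0 => ?_⟩
  have hA : A =ᵐ[volume] (Set.Icc (0 : ι → ℝ) 1).indicator A := by
    filter_upwards [hA0] with x hx
    by_cases h1 : x ∈ Set.Icc (0 : ι → ℝ) 1
    · rw [Set.indicator_of_mem h1]
    · rw [Set.indicator_of_notMem h1, hx h1]
  refine (nnAmalgam_mono_ae (hA.mono fun x hx => hx.le)).trans ((h _ ?_).trans (le_of_eq ?_))
  · intro k hk x hx
    exact Set.indicator_of_notMem (fun h1 => hk (mem_neighbors_of_mem_Icc hx h1)) _
  · rw [← eLpNorm_congr_ae hA, eLpNorm_one_eq_lintegral_enorm]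
    simp

theorem exists_unit_conv_bound (H : Admissible ι p q r ω v) :
    ∃ D : ℝ≥0∞, D ≠ ∞ ∧ ∀ A F : (ι → ℝ) → ℝ≥0∞, Measurable A → Measurable F →
      (∀ᵐ x, x ∉ Set.Icc (0 : ι → ℝ) 1 → A x = 0) →
      nnAmalgam p q ω (nnConv A F) ^ r.toReal
        ≤ D * ((∫⁻ x, A x) ^ r.toReal * nnAmalgam p q ω F ^ r.toReal) := by
  obtain ⟨K, hK, h⟩ := H.exists_conv_bound
  obtain ⟨K', hK', h'⟩ := H.exists_unit_amalgam_bound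
  refine ⟨K * K' ^ r.toReal, ENNReal.mul_ne_top hK
    (ENNReal.rpow_ne_top_of_nonneg H.toReal_r_pos.le hK'), fun A F hA hF hA0 => ?_⟩
  refine (h A F hA hF).trans ?_
  calc _ ≤ K * ((K' * ∫⁻ x, A x) ^ r.toReal * nnAmalgam p q ω F ^ r.toReal) := by
        gcongr
        exact h' A hA0
    _ = _ := by
        rw [ENNReal.mul_rpow_of_nonneg _ _ H.toReal_r_pos.le]
        ring

end General

section Twisted

variable {d : ℕ} {p q r : ℝ≥0∞} {ω v : Phase d → ℝ}

theorem nnAmalgam_tcFun_rpow_le (H : Admissible (Fin d ⊕ Fin d) p q r ω v) (θ : ℝ)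
    {a f : Phase d → ℂ} (ha : StronglyMeasurable a) (hf : StronglyMeasurable f) :
    nnAmalgam p q ω (eabs (tcFun θ a f)) ^ r.toReal
      ≤ ENNReal.ofReal (kappa d) ^ r.toReal *
        nnAmalgam p q ω (nnConv (eabs a) (eabs f)) ^ r.toReal := by
  rw [← ENNReal.mul_rpow_of_nonneg _ _ H.toReal_r_pos.le,
    ← nnAmalgam_const_mul H.one_le_p H.p_lt_top H.q_pos H.q_lt_top ω _
      (measurable_nnConv (measurable_eabs ha) (measurable_eabs hf))]
  exact ENNReal.rpow_le_rpow (nnAmalgam_mono fun X => enorm_tcFun_le θ a f X) H.toReal_r_pos.le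

theorem boxFun_eq_zero {δ : ℝ} {X : Phase d} (hX : X ∉ boxSet d δ) : boxFun d δ X = 0 :=
  Set.indicator_of_notMem hX _

theorem boxSet_subset_Icc {δ : ℝ} (hδ : δ ≤ 1) : boxSet d δ ⊆ Set.Icc 0 1 :=
  Set.Icc_subset_Icc_right fun _ => hδ

/-- Truncations to finitely many cubes belong to `L^p`. -/
theorem memLp_indicator_iUnion_cube (H : Admissible (Fin d ⊕ Fin d) p q r ω v)
    {f : Phase d → ℂ} (hf : StronglyMeasurable f) (h : nnAmalgam p q ω (eabs f) < ∞)
    (t : Finset (Fin d ⊕ Fin d → ℤ)) : MemLp ((⋃ k ∈ t, cube k).indicator f) p volume := by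
  have hS : MeasurableSet (⋃ k ∈ t, cube k : Set (Phase d)) :=
    t.measurableSet_biUnion fun k _ => measurableSet_cube k
  refine ⟨(hf.indicator hS).aestronglyMeasurable, ?_⟩
  rw [eLpNorm_indicator_eq_eLpNorm_restrict hS]
  have hk : ∀ k : Fin d ⊕ Fin d → ℤ, eLpNorm (eabs f) p (volume.restrict (cube k)) < ∞ := by
    intro k
    have hQ : 0 < q.toReal := ENNReal.toReal_pos H.q_pos.ne' H.q_lt_top.ne
    unfold nnAmalgam at h
    rw [eLpNorm_lt_top_iff_lintegral_rpow_enorm_lt_top H.q_pos.ne' H.q_lt_top.ne,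
      lintegral_count] at h
    have h1 := ENNReal.ne_top_of_tsum_ne_top h.ne k
    by_contra hcon
    rw [not_lt, top_le_iff] at hcon
    rw [hcon, ENNReal.top_mul (by simpa using H.weight_pos _)] at h1
    simp [hQ] at h1
  have hU : (⋃ k ∈ t, cube k : Set (Phase d)) = ⋃ k : t, cube (k : Fin d ⊕ Fin d → ℤ) := by
    ext x
    simp
  rw [← eLpNorm_enorm f, hU]
  refine (eLpNorm_restrict_iUnion_le H.one_le_p H.p_lt_top hf.enorm
    fun k => measurableSet_cube _).trans_lt ?_
  rw [tsum_fintype]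
  exact ENNReal.sum_lt_top.2 fun k _ => hk k

theorem eLpNorm_eabs (f : Phase d → ℂ) : eLpNorm (eabs f) p volume = eLpNorm f p volume :=
  eLpNorm_enorm f

theorem tendsto_of_finite_cubes (H : Admissible (Fin d ⊕ Fin d) p q r ω v) (θ : ℝ)
    {f : Phase d → ℂ} (hf : StronglyMeasurable f) (t : Finset (Fin d ⊕ Fin d → ℤ))
    (hft : ∀ x ∉ (⋃ k ∈ t, cube k : Set (Phase d)), f x = 0) (hfp : MemLp f p volume) :
    Tendsto (fun δ => nnAmalgam p q ω (eabs (tcFun θ (boxFun d δ) f - f))) (𝓝[>] 0) (𝓝 0) := by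
  classical
  obtain ⟨K, hK, h⟩ := exists_nnAmalgam_le_eLpNorm (p := p) H.q_pos H.q_lt_top ω
    -- A point of cube `j` moved by a vector of `[0,1]^{2d}` lies only in cubes between `j - 1` and
    -- `j + 2`; the symmetric window contains these. So everything lives on a fixed finite set of
    -- cubes, where `L^p` convergence is enough.
    (t.biUnion fun j => Finset.Icc (j - 2) (j + 2))
  have h1 : Tendsto (fun δ => K * eLpNorm (tcFun θ (boxFun d δ) f - f) p volume)
      (𝓝[>] 0) (𝓝 0) := by
    simpa using ENNReal.Tendsto.const_mul
      (tendsto_eLpNorm_boxFun_tcFun θ hf H.one_le_p H.p_lt_top hfp) (Or.inr hK)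
  refine tendsto_of_tendsto_of_tendsto_of_le_of_le' tendsto_const_nhds h1
    (Eventually.of_forall fun _ => zero_le) ?_
  filter_upwards [Ioo_mem_nhdsGT (zero_lt_one' ℝ)] with δ hδ
  rw [← eLpNorm_eabs]
  refine h _ fun k hk x hx => ?_
  have hfar : ∀ Y ∈ Set.Icc (0 : Phase d) 1, f (x - Y) = 0 := by
    intro Y hY
    refine hft _ fun hcon => hk ?_
    obtain ⟨j, hj, hxj⟩ := Set.mem_iUnion₂.1 hcon
    refine Finset.mem_biUnion.2 ⟨j, hj, Finset.mem_Icc.2 ⟨fun i => ?_, fun i => ?_⟩⟩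
    · have h2 : (j i : ℝ) ≤ x i - Y i := hxj.1 i
      have h3 : (0 : ℝ) ≤ Y i := hY.1 i
      have h4 : x i ≤ k i + 1 := hx.2 i
      have h5 : ((j i - 2 : ℤ) : ℝ) ≤ k i := by
        push_cast
        linarith
      exact Int.cast_le.1 h5
    · have h2 : x i - Y i ≤ j i + 1 := hxj.2 i
      have h3 : Y i ≤ 1 := hY.2 i
      have h4 : (k i : ℝ) ≤ x i := hx.1 i
      have h5 : (k i : ℝ) ≤ ((j i + 2 : ℤ) : ℝ) := by
        push_cast
        linarith
      exact Int.cast_le.1 h5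
  have h2 : tcFun θ (boxFun d δ) f x = 0 := by
    rw [tcFun_swap, tcFun]
    have : (fun Y => f (x - Y) * boxFun d δ Y * phase (-θ) x Y) = fun _ => 0 := by
      funext Y
      by_cases hY : Y ∈ boxSet d δ
      · rw [hfar Y (boxSet_subset_Icc hδ.2.le hY)]
        simp
      · rw [boxFun_eq_zero hY]
        simp
    rw [this]
    simp
  have h3 : f x = 0 := by simpa using hfar 0 ⟨le_rfl, fun _ => zero_le_one⟩
  simp [eabs, h2, h3]

/-- Cut `f` to finitely many cubes, where the `L^p` result applies; the remainder has small
quasi-norm and the boxes act with a bound independent of `δ`. -/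
theorem tendsto_tcFun_boxFun (H : Admissible (Fin d ⊕ Fin d) p q r ω v) (θ : ℝ)
    {f : Phase d → ℂ} (hf : StronglyMeasurable f) (hfN : nnAmalgam p q ω (eabs f) < ∞) :
    Tendsto (fun δ => nnAmalgam p q ω (eabs (tcFun θ (boxFun d δ) f - f)) ^ r.toReal)
      (𝓝[>] 0) (𝓝 0) := by
  obtain ⟨D, hD, hDb⟩ := H.exists_unit_conv_bound
  have hR := H.toReal_r_pos
  rw [ENNReal.tendsto_nhds_zero]
  intro ε hε
  set M : ℝ≥0∞ := ENNReal.ofReal (kappa d) ^ r.toReal *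
    (D * ENNReal.ofReal (kappa d)⁻¹ ^ r.toReal) with hM
  have hMtop : M ≠ ∞ := ENNReal.mul_ne_top
    (ENNReal.rpow_ne_top_of_nonneg hR.le ENNReal.ofReal_ne_top)
    (ENNReal.mul_ne_top hD (ENNReal.rpow_ne_top_of_nonneg hR.le ENNReal.ofReal_ne_top))
  -- `M` bounds the action of the boxes on `r`-th powers. The remainder enters once through that
  -- action and once by itself, for a total of `(M + 1)` times this number.
  have hη : 0 < ε / 2 / (M + 1) :=
    ENNReal.div_pos (ENNReal.half_pos hε.ne').ne' (ENNReal.add_ne_top.2 ⟨hMtop, ENNReal.one_ne_top⟩)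
  obtain ⟨t, ht⟩ := exists_nnAmalgam_indicator_compl_lt H.q_pos H.q_lt_top hfN
    (ENNReal.rpow_pos_of_nonneg hη (inv_pos.2 hR).le)
  set S : Set (Phase d) := ⋃ k ∈ t, cube k with hS
  have hSm : MeasurableSet S := t.measurableSet_biUnion fun k _ => measurableSet_cube k
  have hf1 : StronglyMeasurable (S.indicator f) := hf.indicator hSm
  have hf2 : StronglyMeasurable (Sᶜ.indicator f) := hf.indicator hSm.compl
  have hf2N : nnAmalgam p q ω (eabs (Sᶜ.indicator f)) ^ r.toReal ≤ ε / 2 / (M + 1) := by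
    have e : eabs (Sᶜ.indicator f) = Sᶜ.indicator (eabs f) := by
      funext x
      simp only [eabs, enorm_indicator_eq_indicator_enorm]
      rfl
    rw [e]
    rw [ENNReal.lt_rpow_inv_iff hR] at ht
    exact ht.le
  have hfp1 := H.memLp_indicator_iUnion_cube hf hfN t
  have hf1N : nnAmalgam p q ω (eabs (S.indicator f)) < ∞ := by
    refine (nnAmalgam_mono fun x => ?_).trans_lt hfN
    simp only [eabs, enorm_indicator_eq_indicator_enorm]
    exact Set.indicator_le_self' (fun _ _ => zero_le) x
  have h1 := H.tendsto_of_finite_cubes θ hf1 t (fun x hx => Set.indicator_of_notMem hx _) hfp1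
  have h1' : Tendsto (fun δ => nnAmalgam p q ω
      (eabs (tcFun θ (boxFun d δ) (S.indicator f) - S.indicator f)) ^ r.toReal)
      (𝓝[>] 0) (𝓝 0) := by
    have := (ENNReal.continuous_rpow_const (y := r.toReal)).continuousAt.tendsto.comp h1
    rwa [ENNReal.zero_rpow_of_pos hR] at this
  filter_upwards [ENNReal.tendsto_nhds_zero.1 h1' _ (ENNReal.half_pos hε.ne'),
    Ioo_mem_nhdsGT (zero_lt_one' ℝ)] with δ h2 hδ
  have hb := stronglyMeasurable_boxFun (d := d) δ
  have hb0 : ∀ᵐ x, x ∉ Set.Icc (0 : Phase d) 1 → eabs (boxFun d δ) x = 0 :=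
    Eventually.of_forall fun x hx => by
      simp [eabs, boxFun_eq_zero fun h => hx (boxSet_subset_Icc hδ.2.le h)]
  have hbI := lintegral_eabs_boxFun (d := d) hδ.1
  have hconv : ∀ g : Phase d → ℂ, StronglyMeasurable g → 
      nnAmalgam p q ω (nnConv (eabs (boxFun d δ)) (eabs g)) ^ r.toReal
        ≤ D * (ENNReal.ofReal (kappa d)⁻¹ ^ r.toReal * nnAmalgam p q ω (eabs g) ^ r.toReal) := by
    intro g hg
    have := hDb _ _ (measurable_eabs hb) (measurable_eabs hg) hb0
    rwa [hbI] at this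
  have hfin : ∀ g : Phase d → ℂ, StronglyMeasurable g → nnAmalgam p q ω (eabs g) < ∞ →
      ∀ᵐ X, nnConv (eabs (boxFun d δ)) (eabs g) X < ∞ := by
    intro g hg hgN
    refine H.ae_lt_top (measurable_nnConv (measurable_eabs hb) (measurable_eabs hg)) ?_
    rw [← H.rpow_lt_top_iff]
    refine (hconv g hg).trans_lt (ENNReal.mul_lt_top hD.lt_top (ENNReal.mul_lt_top ?_ ?_))
    · exact H.rpow_lt_top_iff.2 ENNReal.ofReal_lt_top
    · exact H.rpow_lt_top_iff.2 hgN
  have hf2fin : nnAmalgam p q ω (eabs (Sᶜ.indicator f)) < ∞ := by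
    refine (nnAmalgam_mono fun x => ?_).trans_lt hfN
    simp only [eabs, enorm_indicator_eq_indicator_enorm]
    exact Set.indicator_le_self' (fun _ _ => zero_le) x
  set u := tcFun θ (boxFun d δ) (S.indicator f) - S.indicator f with hu
  set w := tcFun θ (boxFun d δ) (Sᶜ.indicator f) with hw
  have hum : StronglyMeasurable u := (stronglyMeasurable_tcFun θ hb hf1).sub hf1
  have hwm : StronglyMeasurable w := stronglyMeasurable_tcFun θ hb hf2
  have hle : ∀ᵐ X, eabs (tcFun θ (boxFun d δ) f - f) X
      ≤ eabs u X + (eabs w X + eabs (Sᶜ.indicator f) X) := by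
    filter_upwards [hfin _ hf1 hf1N, hfin _ hf2 hf2fin] with X h3 h4
    have h5 := tcFun_add_right_apply θ hb hf1 hf2 h3 h4
    rw [Set.indicator_self_add_compl] at h5
    have h6 : f X = S.indicator f X + Sᶜ.indicator f X := by
      rw [← Pi.add_apply, Set.indicator_self_add_compl]
    have h7 : (tcFun θ (boxFun d δ) f - f) X = u X + (w X - Sᶜ.indicator f X) := by
      simp only [Pi.sub_apply, hu, hw, h5]
      rw [h6]
      ring
    simp only [eabs, h7]
    exact (enorm_add_le _ _).trans (add_le_add_right enorm_sub_le _)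
  have hwN : nnAmalgam p q ω (eabs w) ^ r.toReal
      ≤ M * nnAmalgam p q ω (eabs (Sᶜ.indicator f)) ^ r.toReal := by
    refine (H.nnAmalgam_tcFun_rpow_le θ hb hf2).trans ?_
    rw [hM, mul_assoc, mul_assoc]
    exact mul_le_mul_right (hconv _ hf2) _
  have m1 := measurable_eabs hum
  have m2 := measurable_eabs hwm
  have m3 := measurable_eabs hf2
  calc _ ≤ nnAmalgam p q ω (eabs u) ^ r.toReal + (nnAmalgam p q ω (eabs w) ^ r.toReal
          + nnAmalgam p q ω (eabs (Sᶜ.indicator f)) ^ r.toReal) :=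
        (ENNReal.rpow_le_rpow (nnAmalgam_mono_ae hle) hR.le).trans
          ((H.add_rpow_le m1 (m2.add m3)).trans (add_le_add_right (H.add_rpow_le m2 m3) _))
    _ ≤ ε / 2 + (M * (ε / 2 / (M + 1)) + ε / 2 / (M + 1)) := by
        refine add_le_add h2 (add_le_add (hwN.trans ?_) hf2N)
        exact mul_le_mul_right hf2N _
    _ = ε / 2 + (M + 1) * (ε / 2 / (M + 1)) := by ring
    _ = ε := by
        rw [ENNReal.mul_div_cancel (by simp) (ENNReal.add_ne_top.2 ⟨hMtop, ENNReal.one_ne_top⟩),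
          ENNReal.add_halves]

end Twisted

end Admissible

end WienerAmalgam

end

/-! ### The amalgam space as a complete normed group -/

noncomputable section

namespace WienerAmalgam

open Filter Topology

theorem eabs_congr_ae {d : ℕ} {f g : Phase d → ℂ} (h : f =ᵐ[volume] g) :
    eabs f =ᵐ[volume] eabs g := by
  filter_upwards [h] with x hx
  simp [eabs, hx]

theorem nnAmalgam_congr_ae {ι : Type} [Fintype ι] {p q : ℝ≥0∞} {ω : (ι → ℝ) → ℝ}
    {F G : (ι → ℝ) → ℝ≥0∞} (h : F =ᵐ[volume] G) : nnAmalgam p q ω F = nnAmalgam p q ω G :=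
  le_antisymm (nnAmalgam_mono_ae h.le) (nnAmalgam_mono_ae h.symm.le)

section Gauge

variable {d : ℕ} {p q r : ℝ≥0∞} {ω v : Phase d → ℝ}

/-- The `r`-th power of the amalgam quasi-norm, which satisfies the triangle inequality. -/
def gauge (p q r : ℝ≥0∞) (ω : Phase d → ℝ) (f : Phase d →ₘ[volume] ℂ) : ℝ≥0∞ :=
  nnAmalgam p q ω (eabs f) ^ r.toReal

theorem gauge_eq_of_ae {f : Phase d →ₘ[volume] ℂ} {g : Phase d → ℂ} (h : f =ᵐ[volume] g) :
    gauge p q r ω f = nnAmalgam p q ω (eabs g) ^ r.toReal := by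
  rw [gauge, nnAmalgam_congr_ae (eabs_congr_ae h)]

namespace Admissible

variable (H : Admissible (Fin d ⊕ Fin d) p q r ω v)
include H

theorem gauge_lt_top_iff {f : Phase d →ₘ[volume] ℂ} :
    gauge p q r ω f < ∞ ↔ f ∈ wienerAmalgam p q ω := by
  rw [gauge, H.rpow_lt_top_iff]
  change _ ↔ wienerNorm p q ω f < ∞
  rw [wienerNorm_eq_nnAmalgam]
  rfl

theorem gauge_zero : gauge p q r ω (0 : Phase d →ₘ[volume] ℂ) = 0 := by
  rw [gauge_eq_of_ae AEEqFun.coeFn_zero]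
  have : eabs (0 : Phase d → ℂ) = fun _ => 0 * 0 := by
    funext x
    simp [eabs]
  rw [this, nnAmalgam_const_mul H.one_le_p H.p_lt_top H.q_pos H.q_lt_top ω 0 measurable_const,
    zero_mul, ENNReal.zero_rpow_of_pos H.toReal_r_pos]

theorem gauge_smul (c : ℝ) (f : Phase d →ₘ[volume] ℂ) :
    gauge p q r ω (c • f) = ‖c‖ₑ ^ r.toReal * gauge p q r ω f := by
  rw [gauge_eq_of_ae (AEEqFun.coeFn_smul c f), gauge, ← ENNReal.mul_rpow_of_nonneg _ _
    H.toReal_r_pos.le, ← nnAmalgam_const_mul H.one_le_p H.p_lt_top H.q_pos H.q_lt_top ω _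
      (measurable_eabs f.stronglyMeasurable)]
  congr 2
  funext x
  simp only [eabs, Pi.smul_apply, enorm_smul]

theorem gauge_neg (f : Phase d →ₘ[volume] ℂ) : gauge p q r ω (-f) = gauge p q r ω f := by
  rw [← neg_one_smul ℝ f, H.gauge_smul]
  simp

theorem gauge_add_le (f g : Phase d →ₘ[volume] ℂ) :
    gauge p q r ω (f + g) ≤ gauge p q r ω f + gauge p q r ω g := by
  rw [gauge_eq_of_ae (AEEqFun.coeFn_add f g)]
  refine le_trans (ENNReal.rpow_le_rpow (nnAmalgam_mono fun x => ?_) H.toReal_r_pos.le)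
    (H.add_rpow_le (measurable_eabs f.stronglyMeasurable) (measurable_eabs g.stronglyMeasurable))
  exact enorm_add_le _ _

theorem eq_zero_of_gauge_eq_zero {f : Phase d →ₘ[volume] ℂ} (h : gauge p q r ω f = 0) : f = 0 := by
  rw [gauge, ENNReal.rpow_eq_zero_iff_of_pos H.toReal_r_pos] at h
  have h1 := ae_eq_zero_of_nnAmalgam_eq_zero H.one_le_p H.q_pos H.weight_pos
    (measurable_eabs f.stronglyMeasurable) h
  ext1
  filter_upwards [h1, AEEqFun.coeFn_zero (α := Phase d) (μ := volume) (β := ℂ)] with x hx h0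
  rw [h0]
  simpa [eabs] using hx

/-- The series converges absolutely at almost every point, and its pointwise sum serves as `g`; the
tails obey the countable `r`-triangle inequality. This is the Riesz–Fischer argument behind
completeness. -/
theorem exists_gauge_tail_bound (u : ℕ → Phase d →ₘ[volume] ℂ)
    (hu : ∑' n, gauge p q r ω (u n) ≠ ∞) :
    ∃ g : Phase d →ₘ[volume] ℂ, ∀ K, gauge p q r ω (g - ∑ n ∈ Finset.range K, u n)
      ≤ ∑' n, gauge p q r ω (u (n + K)) := by
  have hm : ∀ n, Measurable (eabs (u n)) := fun n => measurable_eabs (u n).stronglyMeasurable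
  have htsum : ∀ K : ℕ, nnAmalgam p q ω (fun x => ∑' n, eabs (u (n + K)) x) ^ r.toReal
      ≤ ∑' n, gauge p q r ω (u (n + K)) := fun K =>
    nnAmalgam_tsum_rpow_le H.r_pos H.r_le_one H.one_le_p H.p_lt_top H.r_le_q H.q_lt_top ω
      fun n => hm (n + K)
  have hfin : ∀ᵐ x, ∑' n, eabs (u n) x < ∞ := by
    refine H.ae_lt_top (Measurable.tsum hm) ?_
    rw [← H.rpow_lt_top_iff]
    exact (htsum 0).trans_lt (by simpa using hu.lt_top)
  have hsum : ∀ᵐ x, Summable fun n => u n x := by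
    filter_upwards [hfin] with x hx
    refine Summable.of_norm ?_
    have h1 : ∑' n, ((‖u n x‖₊ : NNReal) : ℝ≥0∞) ≠ ∞ := hx.ne
    exact NNReal.summable_coe.2 (ENNReal.tsum_coe_ne_top_iff_summable.1 h1)
  have hmeas : AEStronglyMeasurable (fun x => ∑' n, u n x) volume := by
    refine aestronglyMeasurable_of_tendsto_ae atTop
      (f := fun K x => ∑ n ∈ Finset.range K, u n x) (fun K => ?_) ?_
    · exact Finset.aestronglyMeasurable_fun_sum _ fun n _ => (u n).aestronglyMeasurable
    · filter_upwards [hsum] with x hx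
      exact hx.hasSum.tendsto_sum_nat
  refine ⟨AEEqFun.mk _ hmeas, fun K => ?_⟩
  have hpartial : (∑ n ∈ Finset.range K, u n : Phase d →ₘ[volume] ℂ) =ᵐ[volume]
      fun x => ∑ n ∈ Finset.range K, u n x := by
    induction K with
    | zero => simpa using! AEEqFun.coeFn_zero (α := Phase d) (μ := volume) (β := ℂ)
    | succ K ih =>
      rw [Finset.sum_range_succ]
      filter_upwards [ih, AEEqFun.coeFn_add (∑ n ∈ Finset.range K, u n) (u K)] with x h1 h2
      rw [h2, Pi.add_apply, h1, Finset.sum_range_succ]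
  refine le_trans (ENNReal.rpow_le_rpow (nnAmalgam_mono_ae ?_) H.toReal_r_pos.le) (htsum K)
  filter_upwards [AEEqFun.coeFn_sub (AEEqFun.mk _ hmeas) (∑ n ∈ Finset.range K, u n),
    AEEqFun.coeFn_mk _ hmeas, hpartial, hsum] with x h1 h2 h3 h4
  have h5 : ∑' n, u n x - ∑ n ∈ Finset.range K, u n x = ∑' n, u (n + K) x := by
    rw [← h4.sum_add_tsum_nat_add K]
    ring
  rw [eabs, h1, Pi.sub_apply, h2, h3, h5]
  exact enorm_tsum_le_tsum_enorm

end Admissible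

/-- The Wiener amalgam space as a vector space. -/
def Admissible.space (H : Admissible (Fin d ⊕ Fin d) p q r ω v) :
    Submodule ℝ (Phase d →ₘ[volume] ℂ) where
  carrier := {f | gauge p q r ω f < ∞}
  add_mem' hf hg := (H.gauge_add_le _ _).trans_lt (ENNReal.add_lt_top.2 ⟨hf, hg⟩)
  zero_mem' := by
    rw [Set.mem_ofPred_eq, H.gauge_zero]
    exact ENNReal.zero_lt_top
  smul_mem' c f hf := by
    rw [Set.mem_ofPred_eq, H.gauge_smul]
    exact ENNReal.mul_lt_top (H.rpow_lt_top_iff.2 enorm_lt_top) hf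

variable (H : Admissible (Fin d ⊕ Fin d) p q r ω v)

/-- The norm is the `r`-th power of the quasi-norm, so it is homogeneous only of degree `r`. A
complete group norm is all that the contraction and Cauchy arguments need. -/
instance : NormedAddCommGroup H.space :=
  AddGroupNorm.toNormedAddCommGroup
    { toFun := fun f => (gauge p q r ω f).toReal
      map_zero' := by simp [H.gauge_zero]
      add_le' := fun f g => by
        rw [← ENNReal.toReal_add f.2.ne g.2.ne]
        exact ENNReal.toReal_mono (ENNReal.add_lt_top.2 ⟨f.2, g.2⟩).ne (H.gauge_add_le f g)
      neg' := fun f => by simp [H.gauge_neg]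
      eq_zero_of_map_eq_zero' := fun f hf => by
        rcases (ENNReal.toReal_eq_zero_iff _).1 hf with h | h
        · exact Subtype.ext (H.eq_zero_of_gauge_eq_zero h)
        · exact absurd h f.2.ne }

theorem Admissible.norm_def (f : H.space) : ‖f‖ = (gauge p q r ω f).toReal := rfl

theorem Admissible.ofReal_norm_space (f : H.space) : ENNReal.ofReal ‖f‖ = gauge p q r ω f :=
  ENNReal.ofReal_toReal f.2.ne

instance : CompleteSpace H.space := by
  refine NormedAddCommGroup.completeSpace_of_summable_imp_tendsto fun u hu => ?_
  have hsum : ∑' n, gauge p q r ω (u n) ≠ ∞ := by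
    simp only [← H.ofReal_norm_space]
    exact hu.tsum_ofReal_ne_top
  obtain ⟨g, hg⟩ := H.exists_gauge_tail_bound (fun n => u n) hsum
  have hg0 : g ∈ H.space := by
    have h0 := hg 0
    simp only [Finset.range_zero, Finset.sum_empty, sub_zero, add_zero] at h0
    exact h0.trans_lt hsum.lt_top
  refine ⟨⟨g, hg0⟩, ?_⟩
  rw [tendsto_iff_norm_sub_tendsto_zero]
  have h1 := ENNReal.tendsto_sum_nat_add _ hsum
  have h2 : Tendsto (fun K => gauge p q r ω (g - ∑ n ∈ Finset.range K, (u n : Phase d →ₘ[volume] ℂ)))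
      atTop (𝓝 0) :=
    tendsto_of_tendsto_of_tendsto_of_le_of_le tendsto_const_nhds h1 (fun _ => zero_le) hg
  have h3 := (ENNReal.tendsto_toReal ENNReal.zero_ne_top).comp h2
  refine h3.congr fun K => ?_
  rw [norm_sub_rev, H.norm_def]
  simp

end Gauge

end WienerAmalgam

end

/-! ### Supports, and the action of `L¹` functions on the unit cube -/

noncomputable section

namespace WienerAmalgam

open Filter Topology

section Supports

variable {d : ℕ}

/-- The function `b` vanishes almost everywhere outside `[0, s]^{2d}`. -/
def SuppIn (s : ℝ) (b : Phase d →ₘ[volume] ℂ) : Prop := ∀ᵐ x, x ∉ boxSet d s → b x = 0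

theorem SuppIn.mono {s t : ℝ} (hst : s ≤ t) {b : Phase d →ₘ[volume] ℂ} (hb : SuppIn s b) :
    SuppIn t b := by
  filter_upwards [hb] with x hx hxt
  exact hx fun h => hxt (Set.Icc_subset_Icc_right (fun _ => hst) h)

theorem SuppIn.add {s : ℝ} {a b : Phase d →ₘ[volume] ℂ} (ha : SuppIn s a) (hb : SuppIn s b) :
    SuppIn s (a + b) := by
  filter_upwards [ha, hb, AEEqFun.coeFn_add a b] with x h1 h2 h3 hx
  simp [h3, h1 hx, h2 hx]

theorem SuppIn.smul {s : ℝ} {b : Phase d →ₘ[volume] ℂ} (c : ℝ) (hb : SuppIn s b) :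
    SuppIn s (c • b) := by
  filter_upwards [hb, AEEqFun.coeFn_smul c b] with x h2 h3 hx
  simp [h3, h2 hx]

theorem suppIn_zero (s : ℝ) : SuppIn s (0 : Phase d →ₘ[volume] ℂ) := by
  filter_upwards [AEEqFun.coeFn_zero (α := Phase d) (μ := volume) (β := ℂ)] with x h2 _
  simp [h2]

/-- Side lengths add because `[0, s] + [0, t] ⊆ [0, s + t]`. The iteration therefore stays inside
the unit cube if each new box is small enough. -/
theorem SuppIn.tc (θ : ℝ) {s t : ℝ} {b e : Phase d →ₘ[volume] ℂ} (hb : SuppIn s b)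
    (he : SuppIn t e) : SuppIn (s + t) (tc θ b e) := by
  filter_upwards [coeFn_tc θ b e] with X hX hXs
  rw [hX, tcFun]
  have h1 : ∀ᵐ Y, X - Y ∉ boxSet d s → b (X - Y) = 0 :=
    (quasiMeasurePreserving_sub_left volume X).ae hb
  have h2 : (fun Y => b (X - Y) * e Y * phase θ X Y) =ᵐ[volume] fun _ => 0 := by
    filter_upwards [h1, he] with Y h3 h4
    by_cases h5 : X - Y ∈ boxSet d s
    · have h6 : Y ∉ boxSet d t := by
        intro h6
        refine hXs ⟨fun i => ?_, fun i => ?_⟩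
        · have e1 : 0 ≤ X i - Y i := h5.1 i
          have e2 : 0 ≤ Y i := h6.1 i
          change 0 ≤ X i
          linarith
        · have e1 : X i - Y i ≤ s := h5.2 i
          have e2 : Y i ≤ t := h6.2 i
          change X i ≤ s + t
          linarith
      simp [h4 h6]
    · simp [h3 h5]
  rw [integral_congr_ae h2]
  simp

theorem SuppIn.eabs_eq_zero {b : Phase d →ₘ[volume] ℂ} (hb : SuppIn 1 b) :
    ∀ᵐ x, x ∉ Set.Icc (0 : Phase d) 1 → eabs b x = 0 := by
  filter_upwards [hb] with x h1 h2
  rw [eabs, h1 h2, enorm_zero]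

theorem lintegral_eabs (b : Phase d →ₘ[volume] ℂ) : ∫⁻ x, eabs b x = eLpNorm b 1 volume :=
  eLpNorm_one_eq_lintegral_enorm.symm

theorem eLpNorm_tc_lt_top (θ : ℝ) {a b : Phase d →ₘ[volume] ℂ} (ha : eLpNorm a 1 volume < ∞)
    (hb : eLpNorm b 1 volume < ∞) : eLpNorm (WienerAmalgam.tc θ a b) 1 volume < ∞ := by
  rw [eLpNorm_congr_ae (coeFn_tc θ a b)]
  refine (eLpNorm_tcFun_le θ a.stronglyMeasurable b.stronglyMeasurable le_rfl
    ENNReal.one_lt_top).trans_lt ?_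
  rw [lintegral_eabs]
  exact ENNReal.mul_lt_top ENNReal.ofReal_lt_top (ENNReal.mul_lt_top ha hb)

/-- The approximate identity as a class of functions. -/
def box (d : ℕ) (δ : ℝ) : Phase d →ₘ[volume] ℂ :=
  AEEqFun.mk (boxFun d δ) (stronglyMeasurable_boxFun δ).aestronglyMeasurable

theorem coeFn_box (δ : ℝ) : box d δ =ᵐ[volume] boxFun d δ := AEEqFun.coeFn_mk _ _

theorem suppIn_box (δ : ℝ) : SuppIn δ (box d δ) := by
  filter_upwards [coeFn_box (d := d) δ] with x h1 h2
  rw [h1, boxFun, Set.indicator_of_notMem h2]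

theorem eLpNorm_box {δ : ℝ} (hδ : 0 < δ) :
    eLpNorm (box d δ) 1 volume = ENNReal.ofReal (kappa d)⁻¹ := by
  rw [eLpNorm_congr_ae (coeFn_box δ), eLpNorm_one_eq_lintegral_enorm]
  exact lintegral_eabs_boxFun hδ

theorem tendsto_eLpNorm_tc_box (θ : ℝ) {b : Phase d →ₘ[volume] ℂ} (hb : eLpNorm b 1 volume < ∞) :
    Tendsto (fun δ => eLpNorm (tc θ b (box d δ) - b : Phase d →ₘ[volume] ℂ) 1 volume)
      (𝓝[>] 0) (𝓝 0) := by
  refine (tendsto_eLpNorm_boxFun_tcFun (-θ) b.stronglyMeasurable le_rfl ENNReal.one_lt_top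
    ⟨b.aestronglyMeasurable, hb⟩).congr fun δ => eLpNorm_congr_ae ?_
  filter_upwards [AEEqFun.coeFn_sub (tc θ b (box d δ)) b, coeFn_tc θ b (box d δ)] with x h1 h2
  rw [h1, Pi.sub_apply, Pi.sub_apply, h2,
    tcFun_congr θ (EventuallyEq.refl _ _) (coeFn_box δ), tcFun_swap θ]

end Supports

namespace Admissible

variable {d : ℕ} {p q r : ℝ≥0∞} {ω v : Phase d → ℝ}

section Action

variable (H : Admissible (Fin d ⊕ Fin d) p q r ω v)
include H

theorem absConv {a f : Phase d →ₘ[volume] ℂ} (ha : nnAmalgam 1 r v (eabs a) < ∞)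
    (hf : f ∈ H.space) : AbsConv a f :=
  H.ae_lt_top (measurable_nnConv (measurable_eabs a.stronglyMeasurable)
    (measurable_eabs f.stronglyMeasurable))
    (H.nnConv_lt_top (measurable_eabs a.stronglyMeasurable) (measurable_eabs f.stronglyMeasurable)
      ha (H.rpow_lt_top_iff.1 hf))

theorem tc_mem_space (θ : ℝ) {a f : Phase d →ₘ[volume] ℂ} (ha : nnAmalgam 1 r v (eabs a) < ∞)
    (hf : f ∈ H.space) : tc θ a f ∈ H.space := by
  change gauge p q r ω _ < ∞
  rw [gauge_eq_of_ae (coeFn_tc θ a f)]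
  refine (H.nnAmalgam_tcFun_rpow_le θ a.stronglyMeasurable f.stronglyMeasurable).trans_lt ?_
  exact ENNReal.mul_lt_top (H.rpow_lt_top_iff.2 ENNReal.ofReal_lt_top) (H.rpow_lt_top_iff.2
    (H.nnConv_lt_top (measurable_eabs a.stronglyMeasurable) (measurable_eabs f.stronglyMeasurable)
      ha (H.rpow_lt_top_iff.1 hf)))

theorem unit_amalgam_lt_top {b : Phase d →ₘ[volume] ℂ} (hb : SuppIn 1 b)
    (hbL : eLpNorm b 1 volume < ∞) : nnAmalgam 1 r v (eabs b) < ∞ := by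
  obtain ⟨K, hK, h⟩ := H.exists_unit_amalgam_bound
  refine (h _ hb.eabs_eq_zero).trans_lt ?_
  rw [lintegral_eabs]
  exact ENNReal.mul_lt_top hK.lt_top hbL

theorem exists_gauge_tc_bound : ∃ D : ℝ≥0∞, D ≠ ∞ ∧ ∀ (θ : ℝ) (b f : Phase d →ₘ[volume] ℂ),
    SuppIn 1 b → gauge p q r ω (tc θ b f)
      ≤ D * (eLpNorm b 1 volume ^ r.toReal * gauge p q r ω f) := by
  obtain ⟨D, hD, h⟩ := H.exists_unit_conv_bound
  refine ⟨ENNReal.ofReal (kappa d) ^ r.toReal * D, ENNReal.mul_ne_top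
    (H.rpow_lt_top_iff.2 ENNReal.ofReal_lt_top).ne hD, fun θ b f hb => ?_⟩
  rw [gauge_eq_of_ae (coeFn_tc θ b f), mul_assoc, ← lintegral_eabs]
  refine (H.nnAmalgam_tcFun_rpow_le θ b.stronglyMeasurable f.stronglyMeasurable).trans ?_
  exact mul_le_mul_right (h _ _ (measurable_eabs b.stronglyMeasurable)
    (measurable_eabs f.stronglyMeasurable) hb.eabs_eq_zero) _

theorem tc_assoc_of_unit (θ : ℝ) {a b f : Phase d →ₘ[volume] ℂ}
    (ha : nnAmalgam 1 r v (eabs a) < ∞) (hb : nnAmalgam 1 r v (eabs b) < ∞) (hf : f ∈ H.space) :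
    tc θ (tc θ a b) f = tc θ a (tc θ b f) := by
  have ma := measurable_eabs a.stronglyMeasurable
  have mb := measurable_eabs b.stronglyMeasurable
  have mf := measurable_eabs f.stronglyMeasurable
  exact tc_assoc θ (H.ae_lt_top (measurable_nnConv ma (measurable_nnConv mb mf))
    (H.nnConv_lt_top ma (measurable_nnConv mb mf) ha
      (H.nnConv_lt_top mb mf hb (H.rpow_lt_top_iff.1 hf))))

theorem tendsto_gauge_tc_box (θ : ℝ) {f : Phase d →ₘ[volume] ℂ} (hf : f ∈ H.space) :
    Tendsto (fun δ => gauge p q r ω (tc θ (box d δ) f - f)) (𝓝[>] 0) (𝓝 0) := by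
  refine (H.tendsto_tcFun_boxFun θ f.stronglyMeasurable (H.rpow_lt_top_iff.1 hf)).congr fun δ => ?_
  symm
  refine gauge_eq_of_ae ?_
  filter_upwards [AEEqFun.coeFn_sub (tc θ (box d δ) f) f, coeFn_tc θ (box d δ) f] with x h1 h2
  rw [h1, Pi.sub_apply, Pi.sub_apply, h2,
    tcFun_congr θ (coeFn_box δ) (EventuallyEq.refl _ _)]

end Action

/-- The action of `a` on the amalgam space by twisted convolution. -/
def op (H : Admissible (Fin d ⊕ Fin d) p q r ω v) (θ : ℝ) (a : Phase d →ₘ[volume] ℂ)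
    (ha : nnAmalgam 1 r v (eabs a) < ∞) : H.space →ₗ[ℝ] H.space where
  toFun f := ⟨tc θ a f, H.tc_mem_space θ ha f.2⟩
  map_add' f g := Subtype.ext (tc_add_right θ (H.absConv ha f.2) (H.absConv ha g.2))
  map_smul' c f := Subtype.ext (tc_smul_right θ a f c)

section Step

variable (H : Admissible (Fin d ⊕ Fin d) p q r ω v)

theorem norm_smul_space (c : ℝ) (f : H.space) : ‖c • f‖ = |c| ^ r.toReal * ‖f‖ := by
  rw [H.norm_def, H.norm_def, Submodule.coe_smul, H.gauge_smul, ENNReal.toReal_mul,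
    ← ENNReal.toReal_rpow, toReal_enorm, Real.norm_eq_abs]

/-- A small perturbation of the identity is invertible. -/
theorem exists_add_eq (T : H.space →ₗ[ℝ] H.space) (hT : ∀ f, ‖T f‖ ≤ 1 / 2 * ‖f‖) (h : H.space) :
    ∃ w, w + T w = h ∧ ‖w‖ ≤ 2 * ‖h‖ := by
  -- The Neumann series is replaced by a fixed point of `w ↦ h - T w`, which uses only the group
  -- norm and completeness.
  have hc : ContractingWith (1 / 2) (fun w => h - T w) := by
    refine ⟨by
      rw [← NNReal.coe_lt_coe]
      norm_num, LipschitzWith.of_dist_le_mul fun w w' => ?_⟩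
    rw [dist_eq_norm, dist_eq_norm, sub_sub_sub_cancel_left, ← map_sub, norm_sub_rev w]
    simpa using hT (w' - w)
  have hfix : h - T hc.fixedPoint = hc.fixedPoint := hc.fixedPoint_isFixedPt
  set w := hc.fixedPoint
  have e : w + T w = h := by
    nth_rewrite 1 [← hfix]
    exact sub_add_cancel _ _
  refine ⟨w, e, ?_⟩
  have h1 : ‖w‖ ≤ ‖h‖ + ‖T w‖ := by
    nth_rewrite 1 [← hfix]
    exact norm_sub_le _ _
  linarith [hT w]

theorem exists_box_bound (θ : ℝ) : ∃ D : ℝ, 0 ≤ D ∧ ∀ δ (_ : 0 < δ) (_ : δ ≤ 1)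
    (ha : nnAmalgam 1 r v (eabs (box d δ)) < ∞) (f : H.space),
    ‖H.op θ (box d δ) ha f‖ ≤ D * ‖f‖ := by
  obtain ⟨D, hD, h⟩ := H.exists_gauge_tc_bound
  refine ⟨(D * ENNReal.ofReal (kappa d)⁻¹ ^ r.toReal).toReal, ENNReal.toReal_nonneg, ?_⟩
  intro δ hδ hδ1 ha f
  have h1 := h θ (box d δ) f ((suppIn_box δ).mono hδ1)
  rw [eLpNorm_box hδ, ← mul_assoc] at h1
  rw [H.norm_def, H.norm_def, ← ENNReal.toReal_mul]
  refine ENNReal.toReal_mono (ENNReal.mul_ne_top (ENNReal.mul_ne_top hD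
    (H.rpow_lt_top_iff.2 ENNReal.ofReal_lt_top).ne) f.2.ne) h1

theorem exists_scale (θ : ℝ) : ∃ l : ℝ, 0 < l ∧ ∀ δ (_ : 0 < δ) (_ : δ ≤ 1)
    (ha : nnAmalgam 1 r v (eabs (box d δ)) < ∞) (f : H.space),
    ‖(l • H.op θ (box d δ) ha) f‖ ≤ 1 / 2 * ‖f‖ := by
  obtain ⟨D, hD, h⟩ := H.exists_box_bound θ
  have hR := H.toReal_r_pos
  -- The exponent `1 / r` compensates the degree-`r` homogeneity of the norm: `l ^ r = 1 / (2 (D +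
  -- 1))`.
  refine ⟨(1 / (2 * (D + 1))) ^ (r.toReal)⁻¹, by positivity, fun δ hδ hδ1 ha f => ?_⟩
  rw [LinearMap.smul_apply, H.norm_smul_space, abs_of_nonneg (by positivity),
    Real.rpow_inv_rpow (by positivity) hR.ne']
  calc _ ≤ 1 / (2 * (D + 1)) * (D * ‖f‖) := by
        gcongr
        exact h δ hδ hδ1 ha f
    _ = D / (D + 1) * (1 / 2 * ‖f‖) := by field_simp
    _ ≤ 1 * (1 / 2 * ‖f‖) := by
        gcongr
        rw [div_le_one (by positivity)]
        linarith
    _ = _ := one_mul _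

end Step

end Admissible

end WienerAmalgam

end

/-! ### The Cohen–Hewitt iteration and factorization -/

noncomputable section

namespace WienerAmalgam

open Filter Topology

theorem exists_dependent_seq {α : Type*} {P : ℕ → α → Prop} {R : ℕ → α → α → Prop} {x₀ : α}
    (h0 : P 0 x₀) (hstep : ∀ n x, P n x → ∃ y, P (n + 1) y ∧ R n x y) :
    ∃ u : ℕ → α, ∀ n, P n (u n) ∧ R n (u n) (u (n + 1)) := by
  choose F hF using hstep
  let S : (n : ℕ) → {x // P n x} := fun n =>
    Nat.rec ⟨x₀, h0⟩ (fun n x => ⟨F n x.1 x.2, (hF n x.1 x.2).1⟩) n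
  exact ⟨fun n => (S n).1, fun n => ⟨(S n).2, (hF n (S n).1 (S n).2).2⟩⟩

namespace Admissible

variable {d : ℕ} {p q r : ℝ≥0∞} {ω v : Phase d → ℝ}
variable (H : Admissible (Fin d ⊕ Fin d) p q r ω v)

theorem Lp_eLpNorm_lt_top (b : Lp ℂ 1 (volume : Measure (Phase d))) :
    eLpNorm (b : Phase d →ₘ[volume] ℂ) 1 volume < ∞ := Lp.mem_Lp_iff_eLpNorm_lt_top.1 b.2

include H in
-- With a formal unit this reads `(1 + l)⁻¹ (b + m 1)(1 + l e) g' = (b + m 1) g`, which follows from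
-- `(1 + l e) g' = (1 + l) g`. The product is expanded so that only genuine functions occur.
theorem tc_step_identity (θ : ℝ) {l m : ℝ} (hl : 0 < l) {b e g g' : Phase d →ₘ[volume] ℂ}
    (hb : SuppIn 1 b) (he : SuppIn 1 e) (hbe : SuppIn 1 (tc θ b e))
    (hbL : eLpNorm b 1 volume < ∞) (heL : eLpNorm e 1 volume < ∞)
    (hg' : g' ∈ H.space) (h : g' + l • tc θ e g' = (1 + l) • g) :
    tc θ ((1 + l)⁻¹ • b + (((1 + l)⁻¹ * l) • tc θ b e + ((1 + l)⁻¹ * m * l) • e)) g'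
      + ((1 + l)⁻¹ * m) • g' = tc θ b g + m • g := by
  have Nb := H.unit_amalgam_lt_top hb hbL
  have Ne := H.unit_amalgam_lt_top he heL
  have Nbe := H.unit_amalgam_lt_top hbe (eLpNorm_tc_lt_top θ hbL heL)
  have hsm : ∀ (c : ℝ) (a : Phase d →ₘ[volume] ℂ), SuppIn 1 a → eLpNorm a 1 volume < ∞ →
      SuppIn 1 (c • a) ∧ eLpNorm (c • a : Phase d →ₘ[volume] ℂ) 1 volume < ∞ := by
    intro c a ha haL
    refine ⟨ha.smul c, ?_⟩
    rw [eLpNorm_congr_ae (AEEqFun.coeFn_smul c a)]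
    refine eLpNorm_const_smul_le.trans_lt (ENNReal.mul_lt_top enorm_lt_top haL)
  have habs : ∀ a : Phase d →ₘ[volume] ℂ, SuppIn 1 a → eLpNorm a 1 volume < ∞ → AbsConv a g' :=
    fun a ha haL => H.absConv (H.unit_amalgam_lt_top ha haL) hg'
  have h1 := hsm (1 + l)⁻¹ b hb hbL
  have h2 := hsm ((1 + l)⁻¹ * l) _ hbe (eLpNorm_tc_lt_top θ hbL heL)
  have h3 := hsm ((1 + l)⁻¹ * m * l) e he heL
  have h23L : eLpNorm ((((1 + l)⁻¹ * l) • tc θ b e + ((1 + l)⁻¹ * m * l) • e :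
      Phase d →ₘ[volume] ℂ)) 1 volume < ∞ := by
    rw [eLpNorm_congr_ae (AEEqFun.coeFn_add _ _)]
    exact (eLpNorm_add_le (AEEqFun.aestronglyMeasurable _) (AEEqFun.aestronglyMeasurable _)
      le_rfl).trans_lt (ENNReal.add_lt_top.2 ⟨h2.2, h3.2⟩)
  rw [tc_add_left θ (habs _ h1.1 h1.2) (habs _ (h2.1.add h3.1) h23L),
    tc_add_left θ (habs _ h2.1 h2.2) (habs _ h3.1 h3.2), tc_smul_left, tc_smul_left, tc_smul_left,
    H.tc_assoc_of_unit θ Nb Ne hg']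
  have hTg : tc θ e g' ∈ H.space := H.tc_mem_space θ Ne hg'
  have hlTg : l • tc θ e g' ∈ H.space := H.space.smul_mem l hTg
  have key : tc θ b g' + l • tc θ b (tc θ e g') = (1 + l) • tc θ b g := by
    rw [← tc_smul_right θ b g, ← h, tc_add_right θ (H.absConv Nb hg') (H.absConv Nb hlTg),
      tc_smul_right]
  have hl1 : (1 + l) ≠ 0 := by positivity
  have e1 : tc θ b g = (1 + l)⁻¹ • (tc θ b g' + l • tc θ b (tc θ e g')) := by
    rw [key, smul_smul, inv_mul_cancel₀ hl1, one_smul]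
  have e2 : g = (1 + l)⁻¹ • (g' + l • tc θ e g') := by
    rw [h, smul_smul, inv_mul_cancel₀ hl1, one_smul]
  rw [e1]
  nth_rewrite 1 [e2]
  module

/-- One Cohen step. The product is unchanged while the coefficient of the formal unit shrinks by `(1
+ l)⁻¹`. The only change in `b` that cannot be made arbitrarily small is the added multiple of `e`,
whose size is proportional to `m`. -/
theorem exists_step (θ : ℝ) {l : ℝ} (hl : 0 < l)
    (hT : ∀ δ (_ : 0 < δ) (_ : δ ≤ 1) (ha : nnAmalgam 1 r v (eabs (box d δ)) < ∞) (f : H.space),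
      ‖(l • H.op θ (box d δ) ha) f‖ ≤ 1 / 2 * ‖f‖)
    (b : Lp ℂ 1 (volume : Measure (Phase d))) (g : H.space) {s : ℝ} (hs0 : 0 ≤ s) (hs1 : s < 1)
    (hb : SuppIn s (b : Phase d →ₘ[volume] ℂ)) {m : ℝ} (hm : 0 ≤ m) {ε : ℝ} (hε : 0 < ε) :
    ∃ (b' : Lp ℂ 1 (volume : Measure (Phase d))) (g' : H.space) (s' : ℝ), 0 ≤ s' ∧ s' < 1 ∧
      SuppIn s' (b' : Phase d →ₘ[volume] ℂ) ∧
      tc θ b' g' + ((1 + l)⁻¹ * m) • (g' : Phase d →ₘ[volume] ℂ)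
        = tc θ b g + m • (g : Phase d →ₘ[volume] ℂ) ∧
      ‖b' - b‖ ≤ ε + m * (l * (kappa d)⁻¹) ∧ ‖g' - g‖ ≤ ε := by
  have hbL := Lp_eLpNorm_lt_top b
  have hR := H.toReal_r_pos
  have hlR : 0 < l ^ r.toReal := Real.rpow_pos_of_pos hl _
  have lim1 := ENNReal.tendsto_nhds_zero.1 (tendsto_eLpNorm_tc_box θ hbL) (ENNReal.ofReal (ε / l))
    (ENNReal.ofReal_pos.2 (by positivity))
  have lim2 := ENNReal.tendsto_nhds_zero.1 (H.tendsto_gauge_tc_box θ g.2)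
    (ENNReal.ofReal (ε / (2 * l ^ r.toReal))) (ENNReal.ofReal_pos.2 (by positivity))
  -- One `δ` serves three purposes: the box nearly fixes `b` in `L¹`, nearly fixes `g` in the
  -- module, and keeps the enlarged support inside the unit cube.
  obtain ⟨δ, h1, h2, hδ⟩ := (lim1.and (lim2.and
    (Ioo_mem_nhdsGT (show (0 : ℝ) < 1 - s by linarith)))).exists
  have hδ0 : 0 < δ := hδ.1
  have hδ1 : s + δ < 1 := by linarith [hδ.2]
  have heL : eLpNorm (box d δ) 1 volume < ∞ := by
    rw [eLpNorm_box hδ0]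
    exact ENNReal.ofReal_lt_top
  have he : SuppIn 1 (box d δ) := (suppIn_box δ).mono (by linarith)
  have Ne := H.unit_amalgam_lt_top he heL
  -- Writing `g' = g + w` turns `(1 + l e) g' = (1 + l) g` into `(1 + l e) w = l (g - e g)`, whose
  -- right side is small; inverting costs a factor `2`.
  obtain ⟨w, hw, hwn⟩ := H.exists_add_eq _ (hT δ hδ0 (by linarith) Ne)
    (l • (g - H.op θ (box d δ) Ne g))
  have hbe : SuppIn (s + δ) (tc θ (b : Phase d →ₘ[volume] ℂ) (box d δ)) := hb.tc θ (suppIn_box δ)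
  let eL : Lp ℂ 1 (volume : Measure (Phase d)) := ⟨box d δ, Lp.mem_Lp_iff_eLpNorm_lt_top.2 heL⟩
  let beL : Lp ℂ 1 (volume : Measure (Phase d)) :=
    ⟨tc θ b (box d δ), Lp.mem_Lp_iff_eLpNorm_lt_top.2 (eLpNorm_tc_lt_top θ hbL heL)⟩
  have hl1 : (1 + l) ≠ 0 := by positivity
  have hinv : (1 + l)⁻¹ ≤ 1 := inv_le_one_of_one_le₀ (by linarith)
  refine ⟨(1 + l)⁻¹ • b + (((1 + l)⁻¹ * l) • beL + ((1 + l)⁻¹ * m * l) • eL), g + w, s + δ,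
    by linarith, hδ1, ?_, ?_, ?_, ?_⟩
  · exact ((hb.mono (by linarith)).smul _).add
      ((hbe.smul _).add (((suppIn_box δ).mono (by linarith)).smul _))
  · refine H.tc_step_identity θ hl (hb.mono hs1.le) he (hbe.mono hδ1.le) hbL heL (g + w).2 ?_
    have hX : (g + w) + l • H.op θ (box d δ) Ne (g + w) = (1 + l) • g := by
      have hw' : w = l • (g - H.op θ (box d δ) Ne g) - l • H.op θ (box d δ) Ne w :=
        eq_sub_of_add_eq hw
      rw [map_add]
      nth_rewrite 1 [hw']
      module
    exact congrArg (Subtype.val) hX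
  · have e1 : (1 + l)⁻¹ • b + (((1 + l)⁻¹ * l) • beL + ((1 + l)⁻¹ * m * l) • eL) - b
        = ((1 + l)⁻¹ * l) • (beL - b) + ((1 + l)⁻¹ * m * l) • eL := by
      have e2 : (1 + l)⁻¹ * l = 1 - (1 + l)⁻¹ := by field_simp; ring
      rw [e2]
      module
    have n1 : ‖beL - b‖ ≤ ε / l := by
      rw [Lp.norm_def]
      exact ENNReal.toReal_le_of_le_ofReal (by positivity) h1
    have n2 : ‖eL‖ = (kappa d)⁻¹ := by
      rw [Lp.norm_def]
      change (eLpNorm (box d δ) 1 volume).toReal = _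
      rw [eLpNorm_box hδ0, ENNReal.toReal_ofReal (inv_nonneg.2 (kappa_pos d).le)]
    rw [e1]
    refine (norm_add_le _ _).trans ?_
    rw [norm_smul, norm_smul, n2, Real.norm_of_nonneg (by positivity),
      Real.norm_of_nonneg (by positivity)]
    have hk := (inv_pos.2 (kappa_pos d)).le
    calc _ ≤ 1 * l * (ε / l) + 1 * m * l * (kappa d)⁻¹ := by gcongr
      _ = _ := by field_simp
  · rw [add_sub_cancel_left]
    refine hwn.trans ?_
    have n3 : ‖g - H.op θ (box d δ) Ne g‖ ≤ ε / (2 * l ^ r.toReal) := by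
      rw [norm_sub_rev, H.norm_def]
      exact ENNReal.toReal_le_of_le_ofReal (by positivity) h2
    rw [H.norm_smul_space, abs_of_pos hl]
    calc _ ≤ 2 * (l ^ r.toReal * (ε / (2 * l ^ r.toReal))) := by gcongr
      _ = ε := by field_simp

theorem suppIn_of_tendsto {b : ℕ → Lp ℂ 1 (volume : Measure (Phase d))}
    {b₀ : Lp ℂ 1 (volume : Measure (Phase d))} (hb : Tendsto b atTop (𝓝 b₀))
    (hs : ∀ n, SuppIn 1 (b n : Phase d →ₘ[volume] ℂ)) : SuppIn 1 (b₀ : Phase d →ₘ[volume] ℂ) := by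
  have hm := (measurableSet_boxSet (d := d) 1).compl
  have hle : ∀ n, eLpNorm ((boxSet d 1)ᶜ.indicator b₀) 1 volume ≤ ENNReal.ofReal ‖b₀ - b n‖ := by
    intro n
    rw [Lp.norm_def, ENNReal.ofReal_toReal (Lp_eLpNorm_lt_top _).ne]
    refine eLpNorm_mono_enorm_ae ?_
    filter_upwards [hs n, Lp.coeFn_sub b₀ (b n)] with x h1 h2
    by_cases hx : x ∈ boxSet d 1
    · rw [Set.indicator_of_notMem (by simpa using hx)]
      simp
    · rw [Set.indicator_of_mem hx, h2, Pi.sub_apply, h1 hx, sub_zero]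
  have hlim : Tendsto (fun n => ENNReal.ofReal ‖b₀ - b n‖) atTop (𝓝 0) := by
    have h1 := tendsto_iff_norm_sub_tendsto_zero.1 hb
    simp_rw [norm_sub_rev _ b₀] at h1
    simpa using ENNReal.tendsto_ofReal h1
  have h0 : eLpNorm ((boxSet d 1)ᶜ.indicator b₀) 1 volume = 0 :=
    le_antisymm (ge_of_tendsto' hlim hle) zero_le
  rw [eLpNorm_eq_zero_iff ((Lp.aestronglyMeasurable b₀).indicator hm) one_ne_zero] at h0
  filter_upwards [h0] with x hx hx1
  rwa [Set.indicator_of_mem hx1] at hx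

/-- Every element of the amalgam space is a twisted convolution of an integrable function supported
in the unit cube with an element of the amalgam space. -/
theorem exists_factorization (θ : ℝ) (f : H.space) :
    ∃ (b : Lp ℂ 1 (volume : Measure (Phase d))) (g : H.space),
      SuppIn 1 (b : Phase d →ₘ[volume] ℂ) ∧ tc θ b g = (f : Phase d →ₘ[volume] ℂ) := by
  obtain ⟨l, hl, hT⟩ := H.exists_scale θ
  obtain ⟨D, hD, hDb⟩ := H.exists_gauge_tc_bound
  have hR := H.toReal_r_pos
  set μ : ℝ := (1 + l)⁻¹ with hμ
  have hμ0 : 0 < μ := by positivity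
  have hμ1 : μ < 1 := inv_lt_one_of_one_lt₀ (by linarith)
  -- With `ε = m = μ ^ n`, the step bound `ε + m l / κ` for the left factors becomes `C μ ^ n`.
  set C : ℝ := 1 + l * (kappa d)⁻¹ with hC
  obtain ⟨u, hu⟩ := exists_dependent_seq
    (α := Lp ℂ 1 (volume : Measure (Phase d)) × H.space)
    (P := fun n x => (∃ s : ℝ, 0 ≤ s ∧ s < 1 ∧ SuppIn s (x.1 : Phase d →ₘ[volume] ℂ)) ∧
      tc θ (x.1 : Phase d →ₘ[volume] ℂ) (x.2 : Phase d →ₘ[volume] ℂ)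
        + (μ ^ n) • (x.2 : Phase d →ₘ[volume] ℂ) = f)
    (R := fun n x y => ‖y.1 - x.1‖ ≤ C * μ ^ n ∧ ‖y.2 - x.2‖ ≤ C * μ ^ n)
    (x₀ := (0, f)) ⟨⟨0, le_rfl, zero_lt_one, suppIn_zero 0⟩, by
      have h0 := tc_zero_left θ (f : Phase d →ₘ[volume] ℂ)
      simpa using h0⟩ (by
      rintro n ⟨b, g⟩ ⟨⟨s, hs0, hs1, hs⟩, hid⟩
      obtain ⟨b', g', s', hs0', hs1', hs', hid', hb', hg'⟩ :=
        H.exists_step θ hl hT b g hs0 hs1 hs (m := μ ^ n) (by positivity) (ε := μ ^ n) (by positivity)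
      refine ⟨(b', g'), ⟨⟨s', hs0', hs1', hs'⟩, ?_⟩, ?_, ?_⟩
      · rw [pow_succ']
        exact hid'.trans hid
      · exact hb'.trans (le_of_eq (by rw [hC]; ring))
      · refine hg'.trans ?_
        have : 0 ≤ l * (kappa d)⁻¹ := mul_nonneg hl.le (inv_pos.2 (kappa_pos d)).le
        exact le_mul_of_one_le_left (by positivity) (by linarith))
  have hbc : CauchySeq fun n => (u n).1 := cauchySeq_of_le_geometric μ C hμ1 fun n => by
    rw [dist_comm, dist_eq_norm]
    exact (hu n).2.1
  have hgc : CauchySeq fun n => (u n).2 := cauchySeq_of_le_geometric μ C hμ1 fun n => by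
    rw [dist_comm, dist_eq_norm]
    exact (hu n).2.2
  obtain ⟨b, hb⟩ := cauchySeq_tendsto_of_complete hbc
  obtain ⟨g, hg⟩ := cauchySeq_tendsto_of_complete hgc
  have hsn : ∀ n, SuppIn 1 ((u n).1 : Phase d →ₘ[volume] ℂ) := fun n => by
    obtain ⟨s, -, hs1, hs⟩ := (hu n).1.1
    exact hs.mono hs1.le
  have hsb := suppIn_of_tendsto hb hsn
  refine ⟨b, g, hsb, ?_⟩
  have nb : ∀ c : Lp ℂ 1 (volume : Measure (Phase d)),
      eLpNorm (c : Phase d →ₘ[volume] ℂ) 1 volume = ENNReal.ofReal ‖c‖ := fun c => by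
    rw [Lp.norm_def, ENNReal.ofReal_toReal (Lp_eLpNorm_lt_top c).ne]
  have hNb := H.unit_amalgam_lt_top hsb (Lp_eLpNorm_lt_top b)
  -- Insert `f = b_n g_n + μ^n g_n` and split `b g - f` into `-(b_n - b) g`, `-b_n (g_n - g)` and
  -- `-μ^n g_n`. Each tends to zero, so the left side, which is independent of `n`, vanishes.
  have hbound : ∀ n, gauge p q r ω (tc θ b g - (f : Phase d →ₘ[volume] ℂ)) ≤
      D * (ENNReal.ofReal ‖(u n).1 - b‖ ^ r.toReal * ENNReal.ofReal ‖g‖)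
      + (D * (ENNReal.ofReal ‖(u n).1‖ ^ r.toReal * ENNReal.ofReal ‖(u n).2 - g‖)
      + ENNReal.ofReal (μ ^ n) ^ r.toReal * ENNReal.ofReal ‖(u n).2‖) := by
    intro n
    obtain ⟨-, hid⟩ := (hu n).1
    have hsub : SuppIn 1 (((u n).1 - b : Lp ℂ 1 (volume : Measure (Phase d))) :
        Phase d →ₘ[volume] ℂ) := by
      have h1 := (hsn n).add (hsb.smul (-1))
      rw [neg_one_smul ℝ (b : Phase d →ₘ[volume] ℂ), ← sub_eq_add_neg] at h1
      exact h1
    have hNn := H.unit_amalgam_lt_top (hsn n) (Lp_eLpNorm_lt_top (u n).1)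
    have hNs := H.unit_amalgam_lt_top hsub (Lp_eLpNorm_lt_top _)
    have e1 : tc θ (u n).1 g
        = tc θ (((u n).1 - b : Lp ℂ 1 (volume : Measure (Phase d))) : Phase d →ₘ[volume] ℂ) g
          + tc θ b g := by
      rw [← tc_add_left θ (H.absConv hNs g.2) (H.absConv hNb g.2)]
      congr 1
      exact (sub_add_cancel _ _).symm
    have e2 : tc θ (u n).1 (u n).2
        = tc θ (u n).1 (((u n).2 - g : H.space) : Phase d →ₘ[volume] ℂ) + tc θ (u n).1 g := by
      rw [← tc_add_right θ (H.absConv hNn ((u n).2 - g).2) (H.absConv hNn g.2)]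
      congr 1
      exact (sub_add_cancel _ _).symm
    have e3 : tc θ b g - (f : Phase d →ₘ[volume] ℂ)
        = -(tc θ (((u n).1 - b : Lp ℂ 1 (volume : Measure (Phase d))) : Phase d →ₘ[volume] ℂ) g
          + (tc θ (u n).1 (((u n).2 - g : H.space) : Phase d →ₘ[volume] ℂ)
            + (μ ^ n) • ((u n).2 : Phase d →ₘ[volume] ℂ))) := by
      rw [← hid, e2, e1]
      abel
    rw [e3, H.gauge_neg]
    refine (H.gauge_add_le _ _).trans (add_le_add ?_ ((H.gauge_add_le _ _).trans
      (add_le_add ?_ ?_)))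
    · refine (hDb θ _ _ hsub).trans (le_of_eq ?_)
      rw [nb, H.ofReal_norm_space]
    · refine (hDb θ _ _ (hsn n)).trans (le_of_eq ?_)
      rw [nb, H.ofReal_norm_space]
    · rw [H.gauge_smul, H.ofReal_norm_space, ← ofReal_norm, Real.norm_of_nonneg (by positivity)]
  have lim0 : ∀ {x : ℕ → ℝ}, Tendsto x atTop (𝓝 0) →
      Tendsto (fun n => ENNReal.ofReal (x n) ^ r.toReal) atTop (𝓝 0) := by
    intro x hx
    have h1 := (ENNReal.continuous_rpow_const (y := r.toReal)).continuousAt.tendsto.comp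
      (ENNReal.tendsto_ofReal hx)
    simpa [ENNReal.zero_rpow_of_pos hR, Function.comp_def] using h1
  have l1 : Tendsto (fun n => ENNReal.ofReal ‖(u n).1 - b‖ ^ r.toReal) atTop (𝓝 0) :=
    lim0 (tendsto_iff_norm_sub_tendsto_zero.1 hb)
  have l2 : Tendsto (fun n => ENNReal.ofReal ‖(u n).2 - g‖) atTop (𝓝 0) := by
    simpa using ENNReal.tendsto_ofReal (tendsto_iff_norm_sub_tendsto_zero.1 hg)
  have l3 : Tendsto (fun n => ENNReal.ofReal (μ ^ n) ^ r.toReal) atTop (𝓝 0) :=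
    lim0 (tendsto_pow_atTop_nhds_zero_of_lt_one hμ0.le hμ1)
  have l4 : Tendsto (fun n => ENNReal.ofReal ‖(u n).1‖ ^ r.toReal) atTop
      (𝓝 (ENNReal.ofReal ‖b‖ ^ r.toReal)) :=
    (ENNReal.continuous_rpow_const (y := r.toReal)).continuousAt.tendsto.comp
      (ENNReal.tendsto_ofReal hb.norm)
  have l5 : Tendsto (fun n => ENNReal.ofReal ‖(u n).2‖) atTop (𝓝 (ENNReal.ofReal ‖g‖)) :=
    ENNReal.tendsto_ofReal hg.norm
  have hfin : ENNReal.ofReal ‖b‖ ^ r.toReal ≠ ∞ := (H.rpow_lt_top_iff.2 ENNReal.ofReal_lt_top).ne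
  have t1 := ENNReal.Tendsto.const_mul (a := D)
    (ENNReal.Tendsto.mul_const (b := ENNReal.ofReal ‖g‖) l1 (Or.inr ENNReal.ofReal_ne_top))
    (Or.inr hD)
  have t2 := ENNReal.Tendsto.const_mul (a := D)
    (ENNReal.Tendsto.mul l4 (Or.inr ENNReal.zero_ne_top) l2 (Or.inr hfin)) (Or.inr hD)
  have t3 := ENNReal.Tendsto.mul l3 (Or.inr ENNReal.ofReal_ne_top) l5 (Or.inr ENNReal.zero_ne_top)
  have hlim := t1.add (t2.add t3)
  simp only [zero_mul, mul_zero, add_zero] at hlim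
  have hzero : gauge p q r ω (tc θ b g - (f : Phase d →ₘ[volume] ℂ)) = 0 := le_antisymm (ge_of_tendsto' hlim hbound) zero_le
  exact sub_eq_zero.1 (H.eq_zero_of_gauge_eq_zero hzero)

include H in
theorem image2_tc (θ : ℝ) :
    Set.image2 (tc θ) (wienerAmalgam 1 r v) (wienerAmalgam p q ω) = wienerAmalgam p q ω := by
  refine Set.Subset.antisymm ?_ fun f hf => ?_
  · rintro _ ⟨a, ha, f, hf, rfl⟩
    rw [← H.gauge_lt_top_iff] at hf ⊢
    refine H.tc_mem_space θ ?_ hf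
    change wienerNorm 1 r v a < ∞ at ha
    rwa [wienerNorm_eq_nnAmalgam] at ha
  · obtain ⟨b, g, hb, hbg⟩ := H.exists_factorization θ ⟨f, H.gauge_lt_top_iff.2 hf⟩
    refine ⟨b, ?_, g, H.gauge_lt_top_iff.1 g.2, hbg⟩
    change wienerNorm 1 r v b < ∞
    rw [wienerNorm_eq_nnAmalgam]
    exact H.unit_amalgam_lt_top hb (Lp_eLpNorm_lt_top b)

end Admissible

end WienerAmalgam

end

theorem mainTheorem4 (d : ℕ) (r p q : ℝ≥0∞)
    (hr0 : 0 < r) (hr1 : r ≤ 1)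
    (hp1 : 1 ≤ p) (hp : p < ∞)
    (hqr : r ≤ q) (hq : q < ∞)
    (ω v : WienerAmalgam.Phase d → ℝ)
    (hω : ω ∈ WienerAmalgam.moderateWeights (Fin d ⊕ Fin d))
    (hv : v ∈ WienerAmalgam.moderateWeights (Fin d ⊕ Fin d))
    (hωv : WienerAmalgam.IsModerateWrt ω v) :
    (∀ a ∈ WienerAmalgam.wienerAmalgam 1 r v, ∀ f ∈ WienerAmalgam.wienerAmalgam p q ω,
      WienerAmalgam.TwistedConvExists (a : WienerAmalgam.Phase d → ℂ) f ∧
      WienerAmalgam.TwistedConvExists (f : WienerAmalgam.Phase d → ℂ) a) ∧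
    Set.image2 WienerAmalgam.twistedConv
        (WienerAmalgam.wienerAmalgam 1 r v) (WienerAmalgam.wienerAmalgam p q ω)
      = WienerAmalgam.wienerAmalgam p q ω ∧
    Set.image2 WienerAmalgam.twistedConv
        (WienerAmalgam.wienerAmalgam p q ω) (WienerAmalgam.wienerAmalgam 1 r v)
      = WienerAmalgam.wienerAmalgam p q ω := by
  have H : WienerAmalgam.Admissible (Fin d ⊕ Fin d) p q r ω v :=
    ⟨hr0, hr1, hp1, hp, hqr, hq, hω.1.pos, hv, hωv⟩
  refine ⟨fun a ha f hf => ?_, ?_, ?_⟩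
  · change WienerAmalgam.wienerNorm 1 r v a < ∞ at ha
    rw [WienerAmalgam.wienerNorm_eq_nnAmalgam] at ha
    have h := H.absConv ha (H.gauge_lt_top_iff.2 hf)
    exact ⟨h.twistedConvExists, h.symm.twistedConvExists⟩
  · refine Eq.trans ?_ (H.image2_tc 2)
    exact Set.image2_congr fun a _ b _ => WienerAmalgam.twistedConv_eq_tc a b
  -- In the reversed order the amalgam element stands on the left; swapping the factors gives the
  -- left action with phase parameter `-2`.
  · rw [Set.image2_swap]
    refine Eq.trans ?_ (H.image2_tc (-2))
    refine Set.image2_congr fun a _ b _ => ?_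
    rw [WienerAmalgam.twistedConv_eq_tc, WienerAmalgam.tc_swap]
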